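/- Let $1<p<\infty$ and $k\in\mathbb N=\{1,2,\dots\}$. Let $\{e_n\}_{n\ge1}$ be a symmetric basis of the complex sequence space $\ell_p$, i.e. a Schauder basis each of whose permutations is again a Schauder basis equivalent to it. Put $(\Delta c)_n=c_n-c_{n-1}$ with $c_0=0$, and $\ell_p(\Delta^k)=\{\{c_n\}:\Delta^k\{c_n\}\in\ell_p\}$. Let $\ell_{p,k}(\{e_n\})$ be the space of formal series $x=(\mathfrak f)\sum_{n\ge1} c_ne_n$ with $\{c_n\}\in\ell_p(\Delta^k)$, normed by $$\|x\|_k=\Bigl\|\sum_{n=1}^\infty(\Delta^kc)_n\,e_n\Bigr\|_{\ell_p},$$ the series on the right being convergent in $\ell_p$ for every such $x$. Let $\{f(n)\}_{n\ge1}$ be a real sequence with $f(n)\to+\infty$ and $\{n^j\Delta^jf(n)\}_{n\ge1}\in\ell_\infty$ for $1\le j\le k$, and let $\widetilde A_k$ be the operator in $\ell_{p,k}(\{e_n\})$ given by $$\widetilde A_k\,(\mathfrak f)\sum_{n=1}^\infty c_ne_n=(\mathfrak f)\sum_{n=1}^\infty i f(n)\,c_ne_n,\qquad D(\widetilde A_k)=\Bigl\{(\mathfrak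 f)\sum_{n=1}^\infty c_ne_n\in\ell_{p,k}(\{e_n\}):\ \{f(n)c_n\}\in\ell_p(\Delta^k)\Bigr\}.$$ Then for every $a>0$ there is a constant $C>0$ such that every $\lambda\in\mathbb C$ with $\operatorname{Re}\lambda\neq0$ belongs to the resolvent set of $\widetilde A_k$ and $$\bigl\|(\widetilde A_k-\lambda I)^{-1}\bigr\|\le\frac{C}{|\operatorname{Re}\lambda|^{k+1}}\quad\text{whenever }0<|\operatorname{Re}\lambda|<a,$$ $$\bigl\|(\widetilde A_k-\lambda I)^{-1}\bigr\|\le C\quad\text{whenever }|\operatorname{Re}\lambda|\ge a.$$ -/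

import Mathlib

open Filter Topology
open scoped ENNReal

noncomputable section

/-- The complex sequence space `ℓ_p`. -/
abbrev EllP (p : ℝ≥0∞) : Type := lp (fun _ : ℕ => ℂ) p

/-- The difference operator: `(Δ c)_n = c_n - c_{n-1}`, where the sequence is extended by zero to
the left of its first entry. Sequences indexed by `1, 2, 3, …` are represented as functions on `ℕ`,
the entry number `n + 1` being the value at `n`. -/
def diffOp (𝕜 : Type*) [Field 𝕜] : Module.End 𝕜 (ℕ → 𝕜) where
  toFun c n := c n - if n = 0 then 0 else c (n - 1)
  map_add' c d := by
    funext n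
    by_cases h : n = 0
    · simp [h]
    · simp only [h, Pi.add_apply, if_false]
      ring
  map_smul' r c := by
    funext n
    by_cases h : n = 0
    · simp [h]
    · simp only [h, Pi.smul_apply, smul_eq_mul, if_false, RingHom.id_apply]
      ring

/-- The class `𝒮_k`: real sequences `f(1), f(2), …` tending to `+∞` such that
`n ^ j * Δ^j f(n)` is bounded in `n` for every `1 ≤ j ≤ k`. -/
def ClassS (k : ℕ) (f : ℕ → ℝ) : Prop :=
  Tendsto f atTop atTop ∧
    ∀ j : ℕ, 1 ≤ j → j ≤ k → ∃ M : ℝ, ∀ n : ℕ, ((n : ℝ) + 1) ^ j * |(diffOp ℝ ^ j) f n| ≤ M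

/-- The series `∑ α_n e_n` converges to `y` (norm convergence of the partial sums). -/
def SeriesTendsTo {E : Type*} [NormedAddCommGroup E] [NormedSpace ℂ E]
    (e : ℕ → E) (α : ℕ → ℂ) (y : E) : Prop :=
  Tendsto (fun N : ℕ => ∑ n ∈ Finset.range N, α n • e n) atTop (𝓝 y)

/-- Two Schauder bases are equivalent if the same coefficient sequences give convergent series. -/
def BasesEquivalent {E : Type*} [NormedAddCommGroup E] [NormedSpace ℂ E]
    (b b' : SchauderBasis ℂ E) : Prop :=
  ∀ α : ℕ → ℂ, (∃ y, SeriesTendsTo b α y) ↔ (∃ y, SeriesTendsTo b' α y)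

/-- A Schauder basis is symmetric if each of its permutations is again a Schauder basis, equivalent
to it. -/
def IsSymmetricBasis {E : Type*} [NormedAddCommGroup E] [NormedSpace ℂ E]
    (b : SchauderBasis ℂ E) : Prop :=
  ∀ θ : Equiv.Perm ℕ, ∃ b' : SchauderBasis ℂ E, (∀ n, b' n = b (θ n)) ∧ BasesEquivalent b b'

/-- The vector space `ℓ_p(Δ^k) = {c : Δ^k c ∈ ℓ_p}`. A formal series `(𝔣)∑ c_n e_n` is the same
thing as its sequence of coefficients, so this is the vector space underlying `ℓ_{p,k}({e_n})`;
the vectors `e_n` enter through the norm `formalNorm`. -/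
def FormalSpace (p : ℝ≥0∞) (k : ℕ) : Submodule ℂ (ℕ → ℂ) where
  carrier := {c | Memℓp ((diffOp ℂ ^ k) c) p}
  zero_mem' := by
    simp only [Set.mem_ofPred_eq, map_zero]
    exact zero_memℓp
  add_mem' := by
    intro c d hc hd
    simp only [Set.mem_ofPred_eq, map_add] at *
    exact hc.add hd
  smul_mem' := by
    intro r c hc
    simp only [Set.mem_ofPred_eq, map_smul] at *
    exact hc.const_smul r

/-- The norm of `ℓ_{p,k}({e_n})`: `‖(𝔣)∑ c_n e_n‖_k = ‖∑ (Δ^k c)_n e_n‖`, the norm on the right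
being that of `ℓ_p`. -/
def formalNorm {p : ℝ≥0∞} [Fact (1 ≤ p)] (b : SchauderBasis ℂ (EllP p)) {k : ℕ}
    (x : FormalSpace p k) : ℝ :=
  ‖limUnder atTop
    (fun N : ℕ => ∑ n ∈ Finset.range N, ((diffOp ℂ ^ k) (x : ℕ → ℂ) n) • b n)‖

/-- The sequence `i f(n) c_n`. -/
def mulSeq (f : ℕ → ℝ) : Module.End ℂ (ℕ → ℂ) where
  toFun c n := Complex.I * (f n : ℂ) * c n
  map_add' c d := by
    funext n
    simp only [Pi.add_apply]
    ring
  map_smul' r c := by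
    funext n
    simp only [Pi.smul_apply, smul_eq_mul, RingHom.id_apply]
    ring

/-- The sequence `f(n) c_n`. -/
def realMulSeq (f : ℕ → ℝ) : Module.End ℂ (ℕ → ℂ) where
  toFun c n := (f n : ℂ) * c n
  map_add' c d := by
    funext n
    simp only [Pi.add_apply]
    ring
  map_smul' r c := by
    funext n
    simp only [Pi.smul_apply, smul_eq_mul, RingHom.id_apply]
    ring

theorem mulSeq_eq (f : ℕ → ℝ) (c : ℕ → ℂ) : mulSeq f c = Complex.I • realMulSeq f c := by
  funext n
  simp [mulSeq, realMulSeq, mul_assoc]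

/-- The unbounded operator `Ã_k (𝔣)∑ c_n e_n = (𝔣)∑ i f(n) c_n e_n` in `ℓ_{p,k}({e_n})`, with
domain consisting of those elements of the space for which `f(n) c_n` lies in `ℓ_p(Δ^k)`. -/
def opA (p : ℝ≥0∞) (k : ℕ) (f : ℕ → ℝ) : FormalSpace p k →ₗ.[ℂ] FormalSpace p k where
  domain := (FormalSpace p k).comap ((realMulSeq f).comp (FormalSpace p k).subtype)
  toFun :=
    { toFun := fun z => ⟨mulSeq f ((z : FormalSpace p k) : ℕ → ℂ), by
        rw [mulSeq_eq]
        exact (FormalSpace p k).smul_mem _ z.2⟩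
      map_add' := fun z w => by
        apply Subtype.ext
        simp
      map_smul' := fun r z => by
        apply Subtype.ext
        simp }

/-- `R` is the (everywhere defined) two-sided inverse `(A - λ I)⁻¹` of `A - λ I : D(A) → X`. -/
def IsResolventAt {X : Type*} [AddCommGroup X] [Module ℂ X] (A : X →ₗ.[ℂ] X) (lam : ℂ)
    (R : X →ₗ[ℂ] X) : Prop :=
  (∀ x : X, ∃ h : R x ∈ A.domain, A ⟨R x, h⟩ - lam • R x = x) ∧
    ∀ z : A.domain, R (A z - lam • (z : X)) = z

/-- `A - λ I` is invertible with an inverse whose operator norm, relative to the norm `N` on `X`,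
is at most `K`. -/
def ResolventNormLE {X : Type*} [AddCommGroup X] [Module ℂ X] (N : X → ℝ) (A : X →ₗ.[ℂ] X)
    (lam : ℂ) (K : ℝ) : Prop :=
  ∃ R : X →ₗ[ℂ] X, IsResolventAt A lam R ∧ ∀ x : X, N (R x) ≤ K * N x

end

/-! The resolvent can only be multiplication by `g(n) = 1 / (i f(n) - λ)`, so everything reduces to
bounding that multiplier.

A symmetric basis of `ℓ_p` is equivalent to the standard one (`exists_continuousLinearEquiv`).
Symmetry makes any two sparse subsequences equivalent and forces the norms of the basis vectors
between two positive constants. Since `p > 1`, some subsequence is coordinatewise null, and a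
gliding hump makes a further one a small perturbation of disjointly supported vectors, hence
equivalent to the standard basis. Permutations carry this over to the whole basis. Thus the norm of
the formal space is equivalent to the `ℓ_p` norm of `Δ^k c`.

For the multiplier, the Leibniz rule writes `Δ^k (g c)` through products of `Δ^i g` with shifts of
`Δ^(k-i) c`. Hardy's inequality, iterated, bounds `Δ^(k-i) c / n^i` by `Δ^k c` in `ℓ_p`, so it
suffices to bound `n^i Δ^i g`. From `Δ g = -i Δf · g · S g`, up to a term at the first index, each
difference costs one more factor `g`, that is, one more `1 / |Re λ|`, and the hypothesis on `n^j Δ^j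
f` supplies the decay. After `k` differences the bound is of order `|Re λ|^-(k+1)` for small `|Re
λ|`. -/

/-! ### Bounds for `ℓ^t` norms through partial sums -/

/-- The `ℓ^t` norm of the sequence `c` is at most `K`. -/
def SeqNormLE (t : ℝ) (c : ℕ → ℂ) (K : ℝ) : Prop :=
  0 ≤ K ∧ ∀ N : ℕ, ∑ n ∈ Finset.range N, ‖c n‖ ^ t ≤ K ^ t

namespace SeqNormLE

variable {t : ℝ} {c d : ℕ → ℂ} {K L : ℝ}

theorem congr_right (hc : SeqNormLE t c K) (h : K = L) : SeqNormLE t c L := h ▸ hc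

theorem of_norm_le (ht : 0 ≤ t) {A : ℝ} (hA : 0 ≤ A) (h : ∀ n, ‖d n‖ ≤ A * ‖c n‖)
    (hc : SeqNormLE t c K) : SeqNormLE t d (A * K) := by
  refine ⟨mul_nonneg hA hc.1, fun N => ?_⟩
  calc ∑ n ∈ Finset.range N, ‖d n‖ ^ t ≤ ∑ n ∈ Finset.range N, A ^ t * ‖c n‖ ^ t := by
        refine Finset.sum_le_sum fun n _ => ?_
        rw [← Real.mul_rpow hA (norm_nonneg _)]
        exact Real.rpow_le_rpow (norm_nonneg _) (h n) ht
    _ = A ^ t * ∑ n ∈ Finset.range N, ‖c n‖ ^ t := by rw [Finset.mul_sum]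
    _ ≤ A ^ t * K ^ t := by
        gcongr
        exact hc.2 N
    _ = (A * K) ^ t := (Real.mul_rpow hA hc.1).symm

theorem add (ht : 1 ≤ t) (hc : SeqNormLE t c K) (hd : SeqNormLE t d L) :
    SeqNormLE t (c + d) (K + L) := by
  have ht0 : 0 < t := by linarith
  refine ⟨add_nonneg hc.1 hd.1, fun N => ?_⟩
  have hroot : ∀ {x : ℕ → ℂ} {M : ℝ}, SeqNormLE t x M →
      (∑ n ∈ Finset.range N, ‖x n‖ ^ t) ^ (1 / t) ≤ M := by
    intro x M hx
    calc (∑ n ∈ Finset.range N, ‖x n‖ ^ t) ^ (1 / t) ≤ (M ^ t) ^ (1 / t) :=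
          Real.rpow_le_rpow (Finset.sum_nonneg fun _ _ => by positivity) (hx.2 N) (by positivity)
      _ = M := by rw [one_div, Real.rpow_rpow_inv hx.1 ht0.ne']
  have hM := Real.Lp_add_le_of_nonneg (Finset.range N) (f := fun n => ‖c n‖)
    (g := fun n => ‖d n‖) ht (fun _ _ => norm_nonneg _) (fun _ _ => norm_nonneg _)
  have h1 : (∑ n ∈ Finset.range N, (‖c n‖ + ‖d n‖) ^ t) ^ (1 / t) ≤ K + L :=
    hM.trans (add_le_add (hroot hc) (hroot hd))
  have hnn : 0 ≤ ∑ n ∈ Finset.range N, (‖c n‖ + ‖d n‖) ^ t :=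
    Finset.sum_nonneg fun _ _ => by positivity
  calc ∑ n ∈ Finset.range N, ‖(c + d) n‖ ^ t
      ≤ ∑ n ∈ Finset.range N, (‖c n‖ + ‖d n‖) ^ t :=
        Finset.sum_le_sum fun n _ => Real.rpow_le_rpow (norm_nonneg _) (norm_add_le _ _) ht0.le
    _ = ((∑ n ∈ Finset.range N, (‖c n‖ + ‖d n‖) ^ t) ^ (1 / t)) ^ t := by
        rw [one_div, Real.rpow_inv_rpow hnn ht0.ne']
    _ ≤ (K + L) ^ t := Real.rpow_le_rpow (by positivity) h1 ht0.le

theorem of_lp {p : ℝ≥0∞} (hp : 0 < p.toReal) (x : lp (fun _ : ℕ => ℂ) p) :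
    SeqNormLE p.toReal x ‖x‖ :=
  ⟨lp.norm_nonneg' x, fun N => lp.sum_rpow_le_norm_rpow hp x (Finset.range N)⟩

theorem sum_le (hc : SeqNormLE t c K) (s : Finset ℕ) : ∑ n ∈ s, ‖c n‖ ^ t ≤ K ^ t := by
  obtain ⟨N, hN⟩ := s.exists_nat_subset_range
  exact (Finset.sum_le_sum_of_subset_of_nonneg hN fun _ _ _ => by positivity).trans (hc.2 N)

theorem memℓp {p : ℝ≥0∞} (hc : SeqNormLE p.toReal c K) : Memℓp c p :=
  memℓp_gen' hc.sum_le

theorem norm_le {p : ℝ≥0∞} (hp : 0 < p.toReal) {x : lp (fun _ : ℕ => ℂ) p}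
    (hx : SeqNormLE p.toReal x K) : ‖x‖ ≤ K :=
  lp.norm_le_of_forall_sum_le hp hx.1 hx.sum_le

end SeqNormLE

/-! ### Hardy's inequality -/

theorem rpow_sub_one_mul_le {t A B : ℝ} (ht : 1 < t) (hA : 0 ≤ A) (hB : 0 ≤ B) :
    A ^ (t - 1) * B ≤ (t - 1) / t * A ^ t + 1 / t * B ^ t := by
  have ht0 : 0 < t := by linarith
  have h := Real.geom_mean_le_arith_mean2_weighted (w₁ := (t - 1) / t) (w₂ := 1 / t)
    (p₁ := A ^ t) (p₂ := B ^ t) (div_nonneg (by linarith) ht0.le) (by positivity)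
    (by positivity) (by positivity) (by field_simp; ring)
  rwa [← Real.rpow_mul hA, ← Real.rpow_mul hB, mul_div_cancel₀ _ ht0.ne',
    mul_one_div_cancel ht0.ne', Real.rpow_one] at h

/-- Hardy's inequality for finite sums, with the sharp constant. -/
theorem sum_average_rpow_le {t : ℝ} (ht : 1 < t) {a : ℕ → ℝ} (ha : ∀ n, 0 ≤ a n) (N : ℕ) :
    ∑ n ∈ Finset.range N, ((∑ i ∈ Finset.range (n + 1), a i) / ((n : ℝ) + 1)) ^ t ≤
      (t / (t - 1)) ^ t * ∑ n ∈ Finset.range N, a n ^ t := by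
  have ht0 : 0 < t := by linarith
  have ht1 : 0 < t - 1 := by linarith
  -- The default value `A 0 = 0 / 0 = 0` is harmless: it only enters with the factor `n = 0`.
  set A : ℕ → ℝ := fun n => (∑ i ∈ Finset.range n, a i) / (n : ℝ) with hAdef
  have hA : ∀ n, 0 ≤ A n := fun n =>
    div_nonneg (Finset.sum_nonneg fun i _ => ha i) (Nat.cast_nonneg n)
  have hrec : ∀ n : ℕ, a n = ((n : ℝ) + 1) * A (n + 1) - n * A n := by
    intro n
    have h1 : ((n : ℝ) + 1) * A (n + 1) = ∑ i ∈ Finset.range (n + 1), a i := by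
      simp only [hAdef]
      push_cast
      field_simp
    have h2 : (n : ℝ) * A n = ∑ i ∈ Finset.range n, a i := by
      rcases Nat.eq_zero_or_pos n with rfl | hn
      · simp
      · simp only [hAdef]
        field_simp
    rw [h1, h2, Finset.sum_range_succ]
    ring
  -- Substitute `a n = (n + 1) A (n + 1) - n A n` and apply Young to the mixed term; what is left
  -- over telescopes in `n A n ^ t`.
  have key : ∀ n : ℕ, A (n + 1) ^ t + ((n : ℝ) + 1) / (t - 1) * A (n + 1) ^ t ≤
      t / (t - 1) * (A (n + 1) ^ (t - 1) * a n) + n / (t - 1) * A n ^ t := by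
    intro n
    have hy := rpow_sub_one_mul_le ht (hA (n + 1)) (hA n)
    have hpow : A (n + 1) ^ (t - 1) * A (n + 1) = A (n + 1) ^ t := by
      rw [← Real.rpow_add_one' (hA _) (by linarith)]
      congr 1
      ring
    have hn : (0 : ℝ) ≤ n * t / (t - 1) := by positivity
    have h3 := mul_le_mul_of_nonneg_left hy hn
    have h4 : A (n + 1) ^ (t - 1) * a n =
        (n + 1) * A (n + 1) ^ t - n * (A (n + 1) ^ (t - 1) * A n) := by
      conv_lhs => rw [hrec n]
      rw [← hpow]
      ring
    rw [h4]
    have h5 : (n : ℝ) * t / (t - 1) * ((t - 1) / t * A (n + 1) ^ t + 1 / t * A n ^ t) =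
        n * A (n + 1) ^ t + n / (t - 1) * A n ^ t := by
      field_simp
    have h6 : A (n + 1) ^ t + ((n : ℝ) + 1) / (t - 1) * A (n + 1) ^ t =
        t / (t - 1) * ((n + 1) * A (n + 1) ^ t) - n * A (n + 1) ^ t := by
      field_simp
      ring
    have h7 : (n : ℝ) * t / (t - 1) * (A (n + 1) ^ (t - 1) * A n) =
      t / (t - 1) * (n * (A (n + 1) ^ (t - 1) * A n)) := by ring
    rw [h6, mul_sub]
    linarith
  have hsum : ∀ N : ℕ, ∑ n ∈ Finset.range N, A (n + 1) ^ t + (N : ℝ) / (t - 1) * A N ^ t ≤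
      ∑ n ∈ Finset.range N, t / (t - 1) * (A (n + 1) ^ (t - 1) * a n) := by
    intro N
    induction N with
    | zero => simp
    | succ N ih =>
      rw [Finset.sum_range_succ, Finset.sum_range_succ]
      push_cast
      linarith [key N]
  -- A second Young inequality leaves the coefficient `(t - 1) / t < 1` on the sum to be estimated,
  -- which is finite and can be absorbed on the left.
  have hyoung : ∀ n : ℕ, t / (t - 1) * (A (n + 1) ^ (t - 1) * a n) ≤
      (t - 1) / t * A (n + 1) ^ t + 1 / t * ((t / (t - 1)) ^ t * a n ^ t) := by
    intro n
    have h := rpow_sub_one_mul_le ht (hA (n + 1))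
      (mul_nonneg (div_nonneg ht0.le ht1.le) (ha n))
    rw [Real.mul_rpow (div_nonneg ht0.le ht1.le) (ha n)] at h
    calc t / (t - 1) * (A (n + 1) ^ (t - 1) * a n)
        = A (n + 1) ^ (t - 1) * (t / (t - 1) * a n) := by ring
      _ ≤ _ := h
  have hfin : ∑ n ∈ Finset.range N, A (n + 1) ^ t ≤
      (t - 1) / t * ∑ n ∈ Finset.range N, A (n + 1) ^ t +
        1 / t * ((t / (t - 1)) ^ t * ∑ n ∈ Finset.range N, a n ^ t) := by
    have h1 := Finset.sum_le_sum fun n (_ : n ∈ Finset.range N) => hyoung n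
    rw [Finset.sum_add_distrib, ← Finset.mul_sum, ← Finset.mul_sum, ← Finset.mul_sum,
      ← Finset.mul_sum] at h1
    have h2 : 0 ≤ (N : ℝ) / (t - 1) * A N ^ t :=
      mul_nonneg (div_nonneg (Nat.cast_nonneg N) ht1.le) (Real.rpow_nonneg (hA N) t)
    have h3 := hsum N
    rw [← Finset.mul_sum] at h3
    linarith
  have hcoef : (t - 1) / t = 1 - 1 / t := by field_simp
  rw [hcoef] at hfin
  have h3 : 1 / t * ∑ n ∈ Finset.range N, A (n + 1) ^ t ≤
      1 / t * ((t / (t - 1)) ^ t * ∑ n ∈ Finset.range N, a n ^ t) := by linarith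
  have h4 := le_of_mul_le_mul_left h3 (by positivity)
  simpa [hAdef] using h4

theorem SeqNormLE.average {t : ℝ} (ht : 1 < t) {a b : ℕ → ℂ} {K : ℝ} (ha : SeqNormLE t a K)
    (hb : ∀ n : ℕ, ((n : ℝ) + 1) * ‖b n‖ ≤ ∑ i ∈ Finset.range (n + 1), ‖a i‖) :
    SeqNormLE t b (t / (t - 1) * K) := by
  have ht1 : 0 ≤ t / (t - 1) := div_nonneg (by linarith) (by linarith)
  refine ⟨mul_nonneg ht1 ha.1, fun N => ?_⟩
  calc ∑ n ∈ Finset.range N, ‖b n‖ ^ t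
      ≤ ∑ n ∈ Finset.range N, ((∑ i ∈ Finset.range (n + 1), ‖a i‖) / ((n : ℝ) + 1)) ^ t := by
        refine Finset.sum_le_sum fun n _ =>
          Real.rpow_le_rpow (norm_nonneg _) ?_ (by linarith)
        rw [le_div_iff₀ (by positivity), mul_comm]
        exact hb n
    _ ≤ (t / (t - 1)) ^ t * ∑ n ∈ Finset.range N, ‖a n‖ ^ t :=
        sum_average_rpow_le ht (fun n => norm_nonneg _) N
    _ ≤ (t / (t - 1)) ^ t * K ^ t := by
        gcongr
        exact ha.2 N
    _ = (t / (t - 1) * K) ^ t := (Real.mul_rpow ht1 ha.1).symm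

/-! ### The shift and the product rule for differences -/

theorem diffOp_apply (𝕜 : Type*) [Field 𝕜] (c : ℕ → 𝕜) (n : ℕ) :
    diffOp 𝕜 c n = c n - if n = 0 then 0 else c (n - 1) := rfl

/-- The right shift `(S c)_n = c_{n-1}`, where `c` is extended by zero to the left. -/
noncomputable def shiftOp : Module.End ℂ (ℕ → ℂ) := 1 - diffOp ℂ

theorem shiftOp_apply (c : ℕ → ℂ) (n : ℕ) : shiftOp c n = if n = 0 then 0 else c (n - 1) := by
  simp [shiftOp, diffOp]

@[simp] theorem shiftOp_zero (c : ℕ → ℂ) : shiftOp c 0 = 0 := by simp [shiftOp_apply]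

@[simp] theorem shiftOp_succ (c : ℕ → ℂ) (n : ℕ) : shiftOp c (n + 1) = c n := by
  simp [shiftOp_apply]

theorem diffOp_eq_sub (c : ℕ → ℂ) : diffOp ℂ c = c - shiftOp c := by simp [shiftOp]

theorem diffOp_pow_shiftOp (k : ℕ) (c : ℕ → ℂ) :
    (diffOp ℂ ^ k) (shiftOp c) = shiftOp ((diffOp ℂ ^ k) c) := by
  have h : Commute (diffOp ℂ ^ k) shiftOp :=
    ((Commute.one_right _).sub_right (Commute.refl _)).pow_left k
  rw [← Module.End.mul_apply, h.eq, Module.End.mul_apply]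

theorem diffOp_pow_succ (k : ℕ) (c : ℕ → ℂ) :
    (diffOp ℂ ^ (k + 1)) c = (diffOp ℂ ^ k) (diffOp ℂ c) := by
  rw [pow_succ, Module.End.mul_apply]

theorem shiftOp_mul (g c : ℕ → ℂ) : shiftOp (g * c) = shiftOp g * shiftOp c := by
  funext n
  cases n <;> simp

/-- The shift falls on `c` only. It commutes with differences and does not increase `ℓ^t` bounds, so
it costs nothing later. -/
theorem diffOp_mul (g c : ℕ → ℂ) :
    diffOp ℂ (g * c) = g * diffOp ℂ c + diffOp ℂ g * shiftOp c := by
  rw [diffOp_eq_sub, diffOp_eq_sub, diffOp_eq_sub, shiftOp_mul]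
  ring

/-- Extension by zero removes the boundary term, so `c n / (n + 1)` is exactly an average of
differences, as Hardy's inequality requires. -/
theorem sum_diffOp (c : ℕ → ℂ) (n : ℕ) : ∑ i ∈ Finset.range (n + 1), diffOp ℂ c i = c n := by
  induction n with
  | zero => simp [diffOp_eq_sub]
  | succ n ih => rw [Finset.sum_range_succ, ih, diffOp_eq_sub]; simp

theorem SeqNormLE.shift {t : ℝ} (ht : t ≠ 0) {c : ℕ → ℂ} {K : ℝ} (hc : SeqNormLE t c K) :
    SeqNormLE t (shiftOp c) K := by
  refine ⟨hc.1, fun N => ?_⟩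
  cases N with
  | zero => simpa using Real.rpow_nonneg hc.1 t
  | succ N =>
    rw [Finset.sum_range_succ']
    simpa [Real.zero_rpow ht] using hc.2 N

/-- Iterated Hardy inequality. -/
theorem SeqNormLE.div_pow {t : ℝ} (ht : 1 < t) (m : ℕ) {c d : ℕ → ℂ} {K : ℝ}
    (hc : SeqNormLE t ((diffOp ℂ ^ m) c) K)
    (hd : ∀ n : ℕ, ((n : ℝ) + 1) ^ m * ‖d n‖ ≤ ‖c n‖) :
    SeqNormLE t d ((t / (t - 1)) ^ m * K) := by
  induction m generalizing c d with
  | zero =>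
    refine (hc.of_norm_le (by linarith) zero_le_one (d := d) fun n => ?_).congr_right (by simp)
    simpa using hd n
  | succ m ih =>
    rw [diffOp_pow_succ] at hc
    -- The weight `(i + 1) ^ m` grows with `i`, so `|d n|` is at most the average of `|Δc i| / (i +
    -- 1) ^ m`; one Hardy step then completes the induction.
    have h := ih (d := fun n => diffOp ℂ c n / ((n : ℂ) + 1) ^ m) hc (fun n => by
      have : ‖(n : ℂ) + 1‖ = (n : ℝ) + 1 := by
        rw [← Nat.cast_add_one, Complex.norm_natCast]; push_cast; rfl
      rw [norm_div, norm_pow, this, mul_div_cancel₀ _ (by positivity)])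
    refine (h.average ht (b := d) fun n => ?_).congr_right (by ring)
    have hn : (0 : ℝ) < ((n : ℝ) + 1) ^ m := by positivity
    refine le_of_mul_le_mul_left ?_ hn
    calc ((n : ℝ) + 1) ^ m * (((n : ℝ) + 1) * ‖d n‖) = ((n : ℝ) + 1) ^ (m + 1) * ‖d n‖ := by ring
      _ ≤ ‖c n‖ := hd n
      _ = ‖∑ i ∈ Finset.range (n + 1), diffOp ℂ c i‖ := by rw [sum_diffOp]
      _ ≤ ∑ i ∈ Finset.range (n + 1), ‖diffOp ℂ c i‖ := norm_sum_le _ _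
      _ ≤ _ := by
        rw [Finset.mul_sum]
        refine Finset.sum_le_sum fun i hi => ?_
        have hin : (i : ℝ) ≤ n := by
          exact_mod_cast Nat.lt_succ_iff.mp (Finset.mem_range.mp hi)
        have : ‖(i : ℂ) + 1‖ = (i : ℝ) + 1 := by
          rw [← Nat.cast_add_one, Complex.norm_natCast]; push_cast; rfl
        rw [norm_div, norm_pow, this, mul_div_assoc', le_div_iff₀ (by positivity), mul_comm]
        gcongr

/-! ### Sequences whose differences decay -/

/-- `(n + 1) ^ (i + m) * s ^ i * |Δ^i g(n)| ≤ K` for all `i ≤ j` and all `n`. -/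
def DiffBound (s : ℝ) (j m : ℕ) (g : ℕ → ℂ) (K : ℝ) : Prop :=
  ∀ i ≤ j, ∀ n : ℕ, ((n : ℝ) + 1) ^ (i + m) * (s ^ i * ‖(diffOp ℂ ^ i) g n‖) ≤ K

namespace DiffBound

variable {s K L : ℝ} {j m m' : ℕ} {g h : ℕ → ℂ}

theorem nonneg (hg : DiffBound s j m g K) : 0 ≤ K :=
  le_trans (by simp) (hg 0 (Nat.zero_le j) 0)

theorem mono (hg : DiffBound s j m g K) (hKL : K ≤ L) : DiffBound s j m g L :=
  fun i hi n => (hg i hi n).trans hKL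

theorem of_le {j' : ℕ} (hj : j' ≤ j) (hg : DiffBound s j m g K) : DiffBound s j' m g K :=
  fun i hi n => hg i (hi.trans hj) n

theorem norm_le (hg : DiffBound s j m g K) (n : ℕ) : ((n : ℝ) + 1) ^ m * ‖g n‖ ≤ K := by
  simpa using hg 0 (Nat.zero_le j) n

theorem add (hs : 0 ≤ s) (hg : DiffBound s j m g K) (hh : DiffBound s j m h L) :
    DiffBound s j m (g + h) (K + L) := by
  intro i hi n
  calc ((n : ℝ) + 1) ^ (i + m) * (s ^ i * ‖(diffOp ℂ ^ i) (g + h) n‖)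
      ≤ ((n : ℝ) + 1) ^ (i + m) *
          (s ^ i * (‖(diffOp ℂ ^ i) g n‖ + ‖(diffOp ℂ ^ i) h n‖)) := by
        rw [map_add, Pi.add_apply]
        gcongr
        exact norm_add_le _ _
    _ = _ := by ring
    _ ≤ K + L := add_le_add (hg i hi n) (hh i hi n)

theorem const_smul (a : ℂ) (hg : DiffBound s j m g K) : DiffBound s j m (a • g) (‖a‖ * K) := by
  intro i hi n
  rw [map_smul, Pi.smul_apply, norm_smul]
  calc _ = ‖a‖ * (((n : ℝ) + 1) ^ (i + m) * (s ^ i * ‖(diffOp ℂ ^ i) g n‖)) := by ring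
    _ ≤ _ := by gcongr; exact hg i hi n

/-- Engine of the inductions on `j`: a difference gains one power of `n` and costs one factor `1 /
s`, which the weight `s ^ i` records. -/
theorem succ_iff (hs : 0 < s) : DiffBound s (j + 1) m g K ↔
    (∀ n : ℕ, ((n : ℝ) + 1) ^ m * ‖g n‖ ≤ K) ∧ DiffBound s j (m + 1) (diffOp ℂ g) (K / s) := by
  have hshift : ∀ i n : ℕ, ((n : ℝ) + 1) ^ (i + 1 + m) * (s ^ (i + 1) *
      ‖(diffOp ℂ ^ (i + 1)) g n‖) = ((n : ℝ) + 1) ^ (i + (m + 1)) *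
        (s ^ i * ‖(diffOp ℂ ^ i) (diffOp ℂ g) n‖) * s := by
    intro i n
    rw [diffOp_pow_succ]
    ring
  constructor
  · intro hg
    refine ⟨hg.norm_le, fun i hi n => ?_⟩
    rw [le_div_iff₀ hs, ← hshift]
    exact hg (i + 1) (by omega) n
  · rintro ⟨h0, h1⟩ i hi n
    cases i with
    | zero => simpa using h0 n
    | succ i =>
      rw [hshift, ← le_div_iff₀ hs]
      exact h1 i (by omega) n

theorem shift (hs : 0 ≤ s) (hg : DiffBound s j m g K) :
    DiffBound s j m (shiftOp g) (2 ^ (j + m) * K) := by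
  intro i hi n
  have hK := hg.nonneg
  rw [diffOp_pow_shiftOp]
  cases n with
  | zero =>
    rw [shiftOp_zero, norm_zero, mul_zero, mul_zero]
    positivity
  | succ n =>
    rw [shiftOp_succ]
    have h1 : (((n + 1 : ℕ) : ℝ) + 1) ^ (i + m) ≤ 2 ^ (j + m) * ((n : ℝ) + 1) ^ (i + m) := by
      calc (((n + 1 : ℕ) : ℝ) + 1) ^ (i + m) ≤ (2 * ((n : ℝ) + 1)) ^ (i + m) := by
            gcongr
            push_cast
            linarith [Nat.cast_nonneg (α := ℝ) n]
        _ = 2 ^ (i + m) * ((n : ℝ) + 1) ^ (i + m) := mul_pow _ _ _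
        _ ≤ _ := by gcongr; norm_num
    calc (((n + 1 : ℕ) : ℝ) + 1) ^ (i + m) * (s ^ i * ‖(diffOp ℂ ^ i) g n‖)
        ≤ 2 ^ (j + m) * ((n : ℝ) + 1) ^ (i + m) * (s ^ i * ‖(diffOp ℂ ^ i) g n‖) := by gcongr
      _ = 2 ^ (j + m) * (((n : ℝ) + 1) ^ (i + m) * (s ^ i * ‖(diffOp ℂ ^ i) g n‖)) := by ring
      _ ≤ _ := by gcongr; exact hg i hi n

/-- Leibniz rule by induction, with `m` and `m'` free because either factor may receive the
difference. Both terms carry the same `1 / s`, so `C` does not depend on `s`. -/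
theorem exists_mul (j m m' : ℕ) : ∃ C : ℝ, 0 ≤ C ∧ ∀ (s K L : ℝ) (g h : ℕ → ℂ), 0 < s →
    DiffBound s j m g K → DiffBound s j m' h L →
      DiffBound s j (m + m') (g * h) (C * (K * L)) := by
  have hzero : ∀ (j m m' : ℕ) (s K L : ℝ) (g h : ℕ → ℂ), DiffBound s j m g K →
      DiffBound s j m' h L → ∀ n : ℕ, ((n : ℝ) + 1) ^ (m + m') * ‖(g * h) n‖ ≤ K * L := by
    intro j m m' s K L g h hg hh n
    rw [Pi.mul_apply, norm_mul, pow_add]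
    calc _ = (((n : ℝ) + 1) ^ m * ‖g n‖) * (((n : ℝ) + 1) ^ m' * ‖h n‖) := by ring
      _ ≤ K * L := mul_le_mul (hg.norm_le n) (hh.norm_le n) (by positivity) hg.nonneg
  induction j generalizing m m' with
  | zero =>
    refine ⟨1, zero_le_one, fun s K L g h hs hg hh i hi n => ?_⟩
    obtain rfl : i = 0 := by omega
    simpa using hzero 0 m m' s K L g h hg hh n
  | succ j ih =>
    obtain ⟨C₁, hC₁, h₁⟩ := ih m (m' + 1)
    obtain ⟨C₂, hC₂, h₂⟩ := ih (m + 1) m'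
    refine ⟨1 + C₁ + C₂ * 2 ^ (j + m'), by positivity, fun s K L g h hs hg hh => ?_⟩
    have hKL : 0 ≤ K * L := mul_nonneg hg.nonneg hh.nonneg
    obtain ⟨hg0, hg1⟩ := (succ_iff hs).1 hg
    obtain ⟨hh0, hh1⟩ := (succ_iff hs).1 hh
    rw [succ_iff hs]
    constructor
    · intro n
      refine (hzero (j + 1) m m' s K L g h hg hh n).trans ?_
      have : 0 ≤ (C₁ + C₂ * 2 ^ (j + m')) * (K * L) := by positivity
      linarith
    · rw [diffOp_mul]
      have e₁ := h₁ s _ _ _ _ hs (hg.of_le (Nat.le_succ j)) hh1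
      have e₂ := h₂ s _ _ _ _ hs hg1 ((hh.of_le (Nat.le_succ j)).shift hs.le)
      rw [show m + 1 + m' = m + (m' + 1) by ring] at e₂
      rw [show m + m' + 1 = m + (m' + 1) by ring]
      refine (e₁.add hs.le e₂).mono ?_
      have : 0 ≤ K * L / s := by positivity
      calc C₁ * (K * (L / s)) + C₂ * (K / s * (2 ^ (j + m') * L))
          = (C₁ + C₂ * 2 ^ (j + m')) * (K * L / s) := by ring
        _ ≤ (1 + C₁ + C₂ * 2 ^ (j + m')) * (K * L / s) := by gcongr; linarith
        _ = _ := by ring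

/-- `Δ^i` of the spike lives on indices at most `i`, so any decay holds. It is needed for the
boundary term in `diffOp_resolventSeq`. -/
theorem exists_single (j m : ℕ) : ∃ C : ℝ, 0 ≤ C ∧ ∀ s : ℝ, 0 < s → s ≤ 1 →
    DiffBound s j m (Pi.single 0 1) C := by
  have hsupp : ∀ i n : ℕ, i < n → (diffOp ℂ ^ i) (Pi.single 0 1) n = 0 := by
    intro i
    induction i with
    | zero => intro n hn; simp [hn.ne']
    | succ i ih =>
      intro n hn
      rw [pow_succ', Module.End.mul_apply, diffOp_eq_sub]
      obtain ⟨n, rfl⟩ : ∃ l, n = l + 1 := ⟨n - 1, by omega⟩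
      simp [ih (n + 1) (by omega), ih n (by omega)]
  refine ⟨∑ i ∈ Finset.range (j + 1), ∑ n ∈ Finset.range (j + 1), ((n : ℝ) + 1) ^ (i + m) *
    ‖(diffOp ℂ ^ i) (Pi.single 0 1) n‖, by positivity, fun s hs hs1 i hi n => ?_⟩
  rcases lt_or_ge i n with hin | hin
  · rw [hsupp i n hin]
    simp only [norm_zero, mul_zero]
    positivity
  · calc ((n : ℝ) + 1) ^ (i + m) * (s ^ i * ‖(diffOp ℂ ^ i) (Pi.single 0 1) n‖)
        ≤ ((n : ℝ) + 1) ^ (i + m) * (1 * ‖(diffOp ℂ ^ i) (Pi.single 0 1) n‖) := by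
          gcongr
          exact pow_le_one₀ hs.le hs1
      _ = ((n : ℝ) + 1) ^ (i + m) * ‖(diffOp ℂ ^ i) (Pi.single 0 1) n‖ := by rw [one_mul]
      _ ≤ ∑ n ∈ Finset.range (j + 1), ((n : ℝ) + 1) ^ (i + m) *
            ‖(diffOp ℂ ^ i) (Pi.single 0 1) n‖ :=
          Finset.single_le_sum (f := fun n : ℕ => ((n : ℝ) + 1) ^ (i + m) *
            ‖(diffOp ℂ ^ i) (Pi.single 0 1) n‖) (fun _ _ => by positivity)
            (Finset.mem_range.2 (by omega))
      _ ≤ _ := Finset.single_le_sum (f := fun i : ℕ => ∑ n ∈ Finset.range (j + 1),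
            ((n : ℝ) + 1) ^ (i + m) * ‖(diffOp ℂ ^ i) (Pi.single 0 1) n‖)
            (fun _ _ => by positivity) (Finset.mem_range.2 (by omega))

end DiffBound

/-- A sequence with decaying differences multiplies `ℓ^t(Δ^(j+m))` into `ℓ^t(Δ^j)`. -/
theorem SeqNormLE.diffOp_pow_mul {t : ℝ} (ht : 1 < t) (j m : ℕ) :
    ∃ C : ℝ, 0 ≤ C ∧ ∀ (g c : ℕ → ℂ) (A K : ℝ), DiffBound 1 j m g A →
      SeqNormLE t ((diffOp ℂ ^ (j + m)) c) K →
        SeqNormLE t ((diffOp ℂ ^ j) (g * c)) (C * (A * K)) := by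
  have hq : 0 ≤ t / (t - 1) := div_nonneg (by linarith) (by linarith)
  induction j generalizing m with
  | zero =>
    refine ⟨(t / (t - 1)) ^ m, by positivity, fun g c A K hg hc => ?_⟩
    rw [zero_add] at hc
    have h := hc.div_pow ht m (d := fun n => c n / ((n : ℂ) + 1) ^ m) (fun n => by
      have : ‖(n : ℂ) + 1‖ = (n : ℝ) + 1 := by
        rw [← Nat.cast_add_one, Complex.norm_natCast]; push_cast; rfl
      rw [norm_div, norm_pow, this, mul_div_cancel₀ _ (by positivity)])
    refine (h.of_norm_le (by linarith) hg.nonneg fun n => ?_).congr_right (by ring)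
    have : ‖(n : ℂ) + 1‖ = (n : ℝ) + 1 := by
      rw [← Nat.cast_add_one, Complex.norm_natCast]; push_cast; rfl
    rw [pow_zero, Module.End.one_apply, Pi.mul_apply, norm_mul, norm_div, norm_pow, this,
      mul_div_assoc', le_div_iff₀ (by positivity)]
    calc ‖g n‖ * ‖c n‖ * ((n : ℝ) + 1) ^ m = (((n : ℝ) + 1) ^ m * ‖g n‖) * ‖c n‖ := by ring
      _ ≤ A * ‖c n‖ := by gcongr; exact hg.norm_le n
  | succ j ih =>
    obtain ⟨C₁, hC₁, h₁⟩ := ih m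
    obtain ⟨C₂, hC₂, h₂⟩ := ih (m + 1)
    refine ⟨C₁ + C₂, by positivity, fun g c A K hg hc => ?_⟩
    have hg1 := ((DiffBound.succ_iff one_pos).1 hg).2
    rw [div_one] at hg1
    -- In `Δg · S c` the extra decay of `Δg` pays for the difference that `c` did not receive: `m`
    -- becomes `m + 1` and `j + m + 1` is unchanged.
    rw [diffOp_pow_succ, diffOp_mul, map_add]
    refine ((h₁ g (diffOp ℂ c) A K (hg.of_le (Nat.le_succ j)) ?_).add ht.le
      (h₂ (diffOp ℂ g) (shiftOp c) A K hg1 ?_)).congr_right (by ring)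
    · rwa [← diffOp_pow_succ, show j + m + 1 = j + 1 + m by ring]
    · rw [diffOp_pow_shiftOp, show j + (m + 1) = j + 1 + m by ring]
      exact hc.shift (by linarith)

/-! ### The sequence `1 / (i f(n) - λ)` -/

theorem diffOp_pow_ofReal (j : ℕ) (f : ℕ → ℝ) (n : ℕ) :
    (diffOp ℂ ^ j) (fun n => (f n : ℂ)) n = (((diffOp ℝ ^ j) f n : ℝ) : ℂ) := by
  induction j generalizing n with
  | zero => simp
  | succ j ih =>
    rw [pow_succ', pow_succ', Module.End.mul_apply, Module.End.mul_apply]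
    rw [diffOp_apply, diffOp_apply, ih, ih]
    split_ifs <;> simp

theorem ClassS.exists_diffBound {k : ℕ} {f : ℕ → ℝ} (hf : ClassS (k + 1) f) :
    ∃ M : ℝ, ∀ s : ℝ, 0 < s → s ≤ 1 →
      DiffBound s k 1 (diffOp ℂ fun n => (f n : ℂ)) M := by
  have hM : ∀ i : ℕ, ∃ M : ℝ, i ≤ k → ∀ n : ℕ,
      ((n : ℝ) + 1) ^ (i + 1) * |(diffOp ℝ ^ (i + 1)) f n| ≤ M := by
    intro i
    by_cases hi : i ≤ k
    · obtain ⟨M, hM⟩ := hf.2 (i + 1) (by omega) (by omega)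
      exact ⟨M, fun _ => hM⟩
    · exact ⟨0, fun h => absurd h hi⟩
  choose M hM using hM
  refine ⟨∑ i ∈ Finset.range (k + 1), |M i|, fun s hs hs1 i hi n => ?_⟩
  rw [← diffOp_pow_succ, diffOp_pow_ofReal, Complex.norm_real, Real.norm_eq_abs]
  calc ((n : ℝ) + 1) ^ (i + 1) * (s ^ i * |(diffOp ℝ ^ (i + 1)) f n|)
      ≤ ((n : ℝ) + 1) ^ (i + 1) * (1 * |(diffOp ℝ ^ (i + 1)) f n|) := by
        gcongr
        exact pow_le_one₀ hs.le hs1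
    _ ≤ |M i| := by rw [one_mul]; exact (hM i hi n).trans (le_abs_self _)
    _ ≤ _ := Finset.single_le_sum (f := fun i => |M i|) (fun _ _ => abs_nonneg _)
        (Finset.mem_range.2 (by omega))

/-- The sequence `1 / (i f(n) - λ)`. -/
noncomputable def resolventSeq (f : ℕ → ℝ) (lam : ℂ) : ℕ → ℂ :=
  fun n => (Complex.I * (f n : ℂ) - lam)⁻¹

theorem abs_re_le_norm_I_mul_sub (x : ℝ) (lam : ℂ) : |lam.re| ≤ ‖Complex.I * (x : ℂ) - lam‖ := by
  simpa using Complex.abs_re_le_norm (Complex.I * (x : ℂ) - lam)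

theorem I_mul_sub_ne_zero {lam : ℂ} (hl : lam.re ≠ 0) (x : ℝ) :
    Complex.I * (x : ℂ) - lam ≠ 0 := by
  rw [← norm_pos_iff]
  exact (abs_pos.2 hl).trans_le (abs_re_le_norm_I_mul_sub x lam)

/-- This is `1/u - 1/v = (v - u)/(u v)`. At the first index there is no predecessor, and the whole
value survives as a spike. -/
theorem diffOp_resolventSeq (f : ℕ → ℝ) {lam : ℂ} (hl : lam.re ≠ 0) :
    diffOp ℂ (resolventSeq f lam) =
      (-Complex.I) • (diffOp ℂ (fun n => (f n : ℂ)) *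
        (resolventSeq f lam * shiftOp (resolventSeq f lam))) +
      resolventSeq f lam 0 • Pi.single 0 1 := by
  rw [diffOp_eq_sub, diffOp_eq_sub]
  funext n
  cases n with
  | zero => simp
  | succ n =>
    have h1 := I_mul_sub_ne_zero hl (f n)
    have h2 := I_mul_sub_ne_zero hl (f (n + 1))
    simp only [Pi.sub_apply, Pi.add_apply, Pi.smul_apply, Pi.mul_apply, shiftOp_succ, smul_eq_mul,
      Pi.single_apply, resolventSeq]
    simp only [Nat.add_eq_zero_iff, one_ne_zero, and_false, if_false, mul_zero, add_zero]
    field_simp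
    ring

/-- `Δg` is quadratic in `g`, hence of size `1 / s ^ 2`: exactly the loss of one `1 / s` per
difference that `DiffBound.succ_iff` allows. -/
theorem ClassS.exists_diffBound_resolventSeq {k : ℕ} {f : ℕ → ℝ} (hf : ClassS k f) :
    ∃ C : ℝ, 0 ≤ C ∧ ∀ (s : ℝ) (lam : ℂ), 0 < s → s ≤ 1 → s ≤ |lam.re| →
      DiffBound s k 0 (resolventSeq f lam) (C / s) := by
  have hnorm : ∀ (s : ℝ) (lam : ℂ), 0 < s → s ≤ |lam.re| → ∀ n,
      ‖resolventSeq f lam n‖ ≤ 1 / s := by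
    intro s lam hs hl n
    rw [resolventSeq, norm_inv, ← one_div]
    exact one_div_le_one_div_of_le hs (hl.trans (abs_re_le_norm_I_mul_sub _ _))
  induction k with
  | zero =>
    refine ⟨1, zero_le_one, fun s lam hs hs1 hl i hi n => ?_⟩
    obtain rfl : i = 0 := by omega
    simpa using hnorm s lam hs hl n
  | succ k ih =>
    obtain ⟨C₀, hC₀, h₀⟩ := ih ⟨hf.1, fun j h1 hj => hf.2 j h1 (by omega)⟩
    obtain ⟨M, hM⟩ := hf.exists_diffBound
    have hM0 : 0 ≤ M := (hM 1 one_pos le_rfl).nonneg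
    obtain ⟨C₁, hC₁, h₁⟩ := DiffBound.exists_mul k 0 0
    obtain ⟨C₂, hC₂, h₂⟩ := DiffBound.exists_mul k 1 0
    obtain ⟨C₃, hC₃, h₃⟩ := DiffBound.exists_single k 1
    set B : ℝ := C₂ * (M * (C₁ * (C₀ * (2 ^ k * C₀)))) with hB
    refine ⟨1 + B + C₃, by positivity, fun s lam hs hs1 hl => ?_⟩
    have hlam : lam.re ≠ 0 := abs_pos.1 (hs.trans_le hl)
    have hg := h₀ s lam hs hs1 hl
    rw [DiffBound.succ_iff hs]
    constructor
    · intro n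
      rw [pow_zero, one_mul]
      refine (hnorm s lam hs hl n).trans ?_
      have : 0 ≤ B + C₃ := by positivity
      gcongr
      linarith
    · rw [diffOp_resolventSeq f hlam]
      have hprod := h₂ s _ _ _ _ hs (hM s hs hs1) (h₁ s _ _ _ _ hs hg (hg.shift hs.le))
      refine ((hprod.const_smul (-Complex.I)).add hs.le
        ((h₃ s hs hs1).const_smul (resolventSeq f lam 0))).mono ?_
      have e1 : ‖resolventSeq f lam 0‖ * C₃ ≤ C₃ / s / s := by
        calc ‖resolventSeq f lam 0‖ * C₃ ≤ 1 / s * C₃ := by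
              gcongr
              exact hnorm s lam hs hl 0
          _ = C₃ / s := by ring
          _ ≤ C₃ / s / s := le_div_self (by positivity) hs hs1
      have e2 : ‖-Complex.I‖ * (C₂ * (M * (C₁ * (C₀ / s * (2 ^ (k + 0) * (C₀ / s)))))) =
          B / s / s := by
        rw [norm_neg, Complex.norm_I, hB]
        field_simp
        ring_nf
      rw [e2]
      have e3 : 0 ≤ 1 / s / s := by positivity
      calc B / s / s + ‖resolventSeq f lam 0‖ * C₃ ≤ 1 / s / s + B / s / s + C₃ / s / s := by
            linarith
        _ = (1 + B + C₃) / s / s := by ring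

/-- Multiplication by `1 / (i f(n) - λ)` in `ℓ^t(Δ^k)`. -/
theorem ClassS.exists_seqNormLE_resolventSeq_mul {t : ℝ} (ht : 1 < t) {k : ℕ} {f : ℕ → ℝ}
    (hf : ClassS k f) : ∃ C : ℝ, 0 ≤ C ∧ ∀ (s : ℝ) (lam : ℂ) (c : ℕ → ℂ) (K : ℝ),
      0 < s → s ≤ 1 → s ≤ |lam.re| → SeqNormLE t ((diffOp ℂ ^ k) c) K →
        SeqNormLE t ((diffOp ℂ ^ k) (resolventSeq f lam * c)) (C / s ^ (k + 1) * K) := by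
  obtain ⟨C₁, hC₁, h₁⟩ := hf.exists_diffBound_resolventSeq
  obtain ⟨C₂, hC₂, h₂⟩ := SeqNormLE.diffOp_pow_mul ht k 0
  refine ⟨C₂ * C₁, by positivity, fun s lam c K hs hs1 hl hc => ?_⟩
  -- Since `s ≤ 1`, the weights `s ^ i` are at least `s ^ k`; removing them turns `C₁ / s` into `C₁
  -- / s ^ (k + 1)`.
  refine (h₂ _ c (C₁ / s ^ (k + 1)) K (fun i hi n => ?_) hc).congr_right (by ring)
  have h := h₁ s lam hs hs1 hl i hi n
  have hsk : (0 : ℝ) < s ^ k := by positivity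
  have hki : s ^ k ≤ s ^ i := pow_le_pow_of_le_one hs.le hs1 hi
  rw [pow_succ, mul_comm (s ^ k) s, ← div_div, le_div_iff₀ hsk, one_pow, one_mul]
  calc ((n : ℝ) + 1) ^ (i + 0) * ‖(diffOp ℂ ^ i) (resolventSeq f lam) n‖ * s ^ k
      = ((n : ℝ) + 1) ^ (i + 0) * (s ^ k * ‖(diffOp ℂ ^ i) (resolventSeq f lam) n‖) := by ring
    _ ≤ ((n : ℝ) + 1) ^ (i + 0) * (s ^ i * ‖(diffOp ℂ ^ i) (resolventSeq f lam) n‖) := by gcongr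
    _ ≤ C₁ / s := h

/-! ### Convergent series and subsequences -/

/-- The partial sums of `x` converge. -/
def SeriesConv {E : Type*} [NormedAddCommGroup E] (x : ℕ → E) : Prop :=
  ∃ y, Tendsto (fun N : ℕ => ∑ n ∈ Finset.range N, x n) atTop (𝓝 y)

section SeriesConv

variable {E : Type*} [NormedAddCommGroup E] {x y : ℕ → E}

theorem Summable.seriesConv (h : Summable x) : SeriesConv x := ⟨_, h.hasSum.tendsto_sum_nat⟩

theorem SeriesConv.add (hx : SeriesConv x) (hy : SeriesConv y) :
    SeriesConv fun n => x n + y n := by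
  obtain ⟨a, ha⟩ := hx
  obtain ⟨c, hc⟩ := hy
  exact ⟨a + c, by simpa only [Finset.sum_add_distrib] using ha.add hc⟩

theorem SeriesConv.sub (hx : SeriesConv x) (hy : SeriesConv y) :
    SeriesConv fun n => x n - y n := by
  obtain ⟨a, ha⟩ := hx
  obtain ⟨c, hc⟩ := hy
  exact ⟨a - c, by simpa only [Finset.sum_sub_distrib] using ha.sub hc⟩

theorem SeriesConv.tendsto_zero (hx : SeriesConv x) : Tendsto x atTop (𝓝 0) := by
  obtain ⟨a, ha⟩ := hx
  have h := (ha.comp (tendsto_add_atTop_nat 1)).sub ha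
  simpa [Function.comp_def, Finset.sum_range_succ] using h

/-- Omitting zero terms does not change the convergence of a series. -/
theorem seriesConv_comp_iff {h : ℕ → ℕ} (hh : StrictMono h) (hx : ∀ n ∉ Set.range h, x n = 0) :
    SeriesConv (fun j => x (h j)) ↔ SeriesConv x := by
  classical
  have hex : ∀ N, ∃ j, N ≤ h j := fun N => ⟨N, hh.id_le N⟩
  -- `Nat.find (hex N)` counts the `j` with `h j < N`.
  have hlt : ∀ N j, j < Nat.find (hex N) ↔ h j < N := by
    intro N j
    constructor
    · intro hj
      exact not_le.1 (Nat.find_min (hex N) hj)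
    · intro hj
      by_contra! hle
      exact absurd ((Nat.find_spec (hex N)).trans (hh.monotone hle)) (not_le.2 hj)
  have hsum : ∀ N, ∑ j ∈ Finset.range (Nat.find (hex N)), x (h j) =
      ∑ n ∈ Finset.range N, x n := by
    intro N
    rw [← Finset.sum_image (f := x) (g := h) (fun a _ c _ hac => hh.injective hac)]
    refine Finset.sum_subset (fun n hn => ?_) (fun n hn hn' => hx n ?_)
    · obtain ⟨j, hj, rfl⟩ := Finset.mem_image.1 hn
      exact Finset.mem_range.2 ((hlt N j).1 (Finset.mem_range.1 hj))
    · rintro ⟨j, rfl⟩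
      exact hn' (Finset.mem_image.2
        ⟨j, Finset.mem_range.2 ((hlt N j).2 (Finset.mem_range.1 hn)), rfl⟩)
  constructor
  · rintro ⟨a, ha⟩
    refine ⟨a, ?_⟩
    have htop : Tendsto (fun N => Nat.find (hex N)) atTop atTop := by
      refine tendsto_atTop.2 fun J => ?_
      filter_upwards [eventually_gt_atTop (h J)] with N hN
      exact ((hlt N J).2 hN).le
    refine (ha.comp htop).congr fun N => ?_
    exact hsum N
  · rintro ⟨a, ha⟩
    refine ⟨a, (ha.comp hh.tendsto_atTop).congr fun J => ?_⟩
    have hJ : Nat.find (hex (h J)) = J := by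
      refine le_antisymm (Nat.find_le le_rfl) ?_
      by_contra! hlt'
      exact absurd (Nat.find_spec (hex (h J))) (not_le.2 (hh hlt'))
    have := hsum (h J)
    rw [hJ] at this
    exact this.symm

end SeriesConv

/-- The complements of the ranges are both countably infinite, so a bijection between them completes
`h j ↦ g j` to a permutation. -/
theorem exists_perm_comp_eq {h g : ℕ → ℕ} (hh : h.Injective) (hg : g.Injective)
    (hh' : (Set.range h)ᶜ.Infinite) (hg' : (Set.range g)ᶜ.Infinite) :
    ∃ θ : Equiv.Perm ℕ, ∀ j, θ (h j) = g j := by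
  let F : Set.range h ↪ ℕ :=
    ⟨fun x => g ((Equiv.ofInjective h hh).symm x),
      fun x y hxy => (Equiv.ofInjective h hh).symm.injective (hg hxy)⟩
  have hF : Set.range F = Set.range g := by
    change Set.range (g ∘ (Equiv.ofInjective h hh).symm) = _
    rw [Set.range_comp, Equiv.range_eq_univ, Set.image_univ]
  have : Infinite ((Set.range h)ᶜ : Set ℕ) := hh'.to_subtype
  have : Infinite ((Set.range F)ᶜ : Set ℕ) := by rw [hF]; exact hg'.to_subtype
  obtain ⟨θ, hθ⟩ := Cardinal.extend_function F nonempty_equiv_of_countable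
  refine ⟨θ, fun j => ?_⟩
  have := hθ ⟨h j, j, rfl⟩
  rw [this]
  change g ((Equiv.ofInjective h hh).symm ⟨h j, j, rfl⟩) = g j
  congr 1
  exact Equiv.ofInjective_symm_apply hh j

theorem infinite_compl_range_two_mul : (Set.range fun j : ℕ => 2 * j)ᶜ.Infinite := by
  refine Set.infinite_of_injective_forall_mem (f := fun j : ℕ => 2 * j + 1)
    (fun a c h => by simpa using h) ?_
  rintro j ⟨i, hi⟩
  simp only at hi
  omega

theorem infinite_compl_range_two_mul_add_one : (Set.range fun j : ℕ => 2 * j + 1)ᶜ.Infinite := by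
  refine Set.infinite_of_injective_forall_mem (f := fun j : ℕ => 2 * j)
    (fun a c h => by simpa using h) ?_
  rintro j ⟨i, hi⟩
  simp only at hi
  omega

/-- A choice of indices as in `Filter.extraction_forall_of_frequently`, which moreover leaves out
infinitely many indices. -/
theorem exists_strictMono_infinite_compl {P : ℕ → ℕ → Prop} (hP : ∀ n, ∃ᶠ k in atTop, P n k) :
    ∃ g : ℕ → ℕ, StrictMono g ∧ (Set.range g)ᶜ.Infinite ∧ ∀ n, P n (g n) := by
  -- Each requirement is met twice, at `2 n` and `2 n + 1`; keeping the even choices leaves the odd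
  -- ones unused.
  obtain ⟨φ, hφ, hφP⟩ := extraction_forall_of_frequently
    (P := fun n k => P (n / 2) k) (fun n => hP (n / 2))
  refine ⟨fun n => φ (2 * n), fun a c hac => hφ (by omega), ?_, fun n => ?_⟩
  · refine Set.infinite_of_injective_forall_mem (f := fun j : ℕ => φ (2 * j + 1))
      (fun a c h => by simpa using hφ.injective h) ?_
    rintro j ⟨i, hi⟩
    have := hφ.injective hi
    omega
  · simpa using hφP (2 * n)

/-! ### Symmetric bases -/

section Symmetric

variable {E : Type*} [NormedAddCommGroup E] [NormedSpace ℂ E] {b : SchauderBasis ℂ E}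

theorem SchauderBasis.tendsto_expansion (b : SchauderBasis ℂ E) (x : E) :
    Tendsto (fun N => ∑ n ∈ Finset.range N, b.coord n x • b n) atTop (𝓝 x) := by
  simpa using SchauderBasis.tendsto_proj b x

theorem SchauderBasis.coord_self (b : SchauderBasis ℂ E) (m n : ℕ) :
    b.coord m (b n) = if m = n then 1 else 0 := by
  rw [b.ortho]
  by_cases h : m = n
  · subst h
    simp
  · simp [h]

theorem SchauderBasis.eq_zero_of_coord (b : SchauderBasis ℂ E) {x : E}
    (hx : ∀ m, b.coord m x = 0) : x = 0 := by
  have h := SchauderBasis.tendsto_expansion b x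
  simp only [hx, zero_smul, Finset.sum_const_zero] at h
  exact tendsto_nhds_unique h tendsto_const_nhds

theorem SchauderBasis.norm_pos (b : SchauderBasis ℂ E) (n : ℕ) : 0 < ‖b n‖ := by
  rw [norm_pos_iff]
  intro h
  have := SchauderBasis.coord_self b n n
  simp [h] at this

theorem SeriesTendsTo.coord_eq {α : ℕ → ℂ} {y : E} (h : SeriesTendsTo b α y) (m : ℕ) :
    b.coord m y = α m := by
  refine tendsto_nhds_unique (((b.coord m).continuous.tendsto y).comp h)
    (tendsto_const_nhds.congr' ?_)
  filter_upwards [eventually_gt_atTop m] with N hN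
  simp [SchauderBasis.coord_self, hN]

theorem IsSymmetricBasis.seriesConv_perm (hb : IsSymmetricBasis b) (θ : Equiv.Perm ℕ)
    (α : ℕ → ℂ) : SeriesConv (fun n => α n • b n) ↔ SeriesConv (fun n => α n • b (θ n)) := by
  obtain ⟨b', hb', he⟩ := hb θ
  have := he α
  simpa only [SeriesConv, SeriesTendsTo, hb'] using this

/-- Sparse subsequences of a symmetric basis are equivalent. -/
theorem IsSymmetricBasis.seriesConv_comp (hb : IsSymmetricBasis b) {h g : ℕ → ℕ}
    (hh : StrictMono h) (hg : g.Injective) (hh' : (Set.range h)ᶜ.Infinite)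
    (hg' : (Set.range g)ᶜ.Infinite) (β : ℕ → ℂ) :
    SeriesConv (fun j => β j • b (h j)) ↔ SeriesConv (fun j => β j • b (g j)) := by
  obtain ⟨θ, hθ⟩ := exists_perm_comp_eq hh.injective hg hh' hg'
  have h0 : ∀ n ∉ Set.range h, Function.extend h β 0 n = 0 := fun n hn => by
    rw [Function.extend_apply' _ _ _ (by simpa using hn), Pi.zero_apply]
  have h1 := seriesConv_comp_iff (x := fun n => Function.extend h β 0 n • b n) hh
    (fun n hn => by simp only [h0 n hn, zero_smul])
  have h2 := seriesConv_comp_iff (x := fun n => Function.extend h β 0 n • b (θ n)) hh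
    (fun n hn => by simp only [h0 n hn, zero_smul])
  simp only [hh.injective.extend_apply, hθ] at h1 h2
  rw [h1, h2]
  exact hb.seriesConv_perm θ _

theorem summable_half_pow : Summable fun j : ℕ => (1 / 2 : ℝ) ^ j :=
  summable_geometric_of_lt_one (by norm_num) (by norm_num)

theorem strictMono_two_mul : StrictMono fun j : ℕ => 2 * j := fun a c h => by
  simp only
  omega

/-- Otherwise some sparse `g` has `‖b (g j)‖ ≥ 2 ^ j ‖b (2 j)‖`. Coefficients of size `2 ^ -j / ‖b
(2 j)‖` then give absolute convergence along the even indices but terms of norm at least 1 along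
`g`. -/
theorem IsSymmetricBasis.exists_norm_le [CompleteSpace E] (hb : IsSymmetricBasis b) :
    ∃ M : ℝ, ∀ n, ‖b n‖ ≤ M := by
  by_contra! hM
  obtain ⟨g, hg, hg', hP⟩ := exists_strictMono_infinite_compl
    (P := fun j k => 2 ^ j * ‖b (2 * j)‖ ≤ ‖b k‖) (fun j => by
      rw [frequently_atTop]
      intro N
      obtain ⟨n, hn⟩ := hM (2 ^ j * ‖b (2 * j)‖ + ∑ i ∈ Finset.range N, ‖b i‖)
      have hs : 0 ≤ ∑ i ∈ Finset.range N, ‖b i‖ := by positivity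
      have hs' : 0 ≤ 2 ^ j * ‖b (2 * j)‖ := by positivity
      refine ⟨n, ?_, by linarith⟩
      by_contra! hlt
      have := Finset.single_le_sum (f := fun i => ‖b i‖) (fun _ _ => norm_nonneg _)
        (Finset.mem_range.2 hlt)
      linarith)
  obtain ⟨β, hβn⟩ : ∃ β : ℕ → ℂ, ∀ j, ‖β j‖ = (1 / 2 : ℝ) ^ j / ‖b (2 * j)‖ :=
    ⟨fun j => (((1 / 2 : ℝ) ^ j / ‖b (2 * j)‖ : ℝ) : ℂ), fun j => by
      rw [Complex.norm_real, Real.norm_of_nonneg (by positivity)]⟩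
  have hiff : SeriesConv (fun j => β j • b (2 * j)) ↔ SeriesConv (fun j => β j • b (g j)) :=
    hb.seriesConv_comp strictMono_two_mul hg.injective infinite_compl_range_two_mul hg' β
  have h1 : SeriesConv fun j => β j • b (2 * j) := by
    apply Summable.seriesConv
    apply Summable.of_norm
    refine summable_half_pow.congr fun j => ?_
    rw [norm_smul, hβn, div_mul_cancel₀ _ (SchauderBasis.norm_pos b _).ne']
  have h2 := (hiff.1 h1).tendsto_zero.norm
  rw [norm_zero] at h2
  obtain ⟨j, hj⟩ := (h2.eventually_lt_const one_pos).exists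
  rw [norm_smul, hβn] at hj
  have h3 : (1 / 2 : ℝ) ^ j / ‖b (2 * j)‖ * (2 ^ j * ‖b (2 * j)‖) = 1 := by
    have := (SchauderBasis.norm_pos b (2 * j)).ne'
    rw [one_div, inv_pow]
    field_simp
  have h4 := mul_le_mul_of_nonneg_left (hP j)
    (show 0 ≤ (1 / 2 : ℝ) ^ j / ‖b (2 * j)‖ by positivity)
  linarith

/-- The mirror argument: normalise along the even indices and make the series along `g` absolutely
convergent. -/
theorem IsSymmetricBasis.exists_le_norm [CompleteSpace E] (hb : IsSymmetricBasis b) :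
    ∃ δ : ℝ, 0 < δ ∧ ∀ n, δ ≤ ‖b n‖ := by
  by_contra! hδ
  obtain ⟨g, hg, hg', hP⟩ := exists_strictMono_infinite_compl
    (P := fun j k => ‖b k‖ ≤ (1 / 2) ^ j * ‖b (2 * j)‖) (fun j => by
      rw [frequently_atTop]
      intro N
      have hpos := SchauderBasis.norm_pos b
      have hfin : ∃ η : ℝ, 0 < η ∧ ∀ i < N, η ≤ ‖b i‖ := by
        induction N with
        | zero => exact ⟨1, one_pos, by simp⟩
        | succ N ih =>
          obtain ⟨η, hη, h⟩ := ih
          refine ⟨min η ‖b N‖, lt_min hη (hpos N), fun i hi => ?_⟩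
          rcases Nat.lt_succ_iff_lt_or_eq.1 hi with hi | rfl
          · exact (min_le_left _ _).trans (h i hi)
          · exact min_le_right _ _
      obtain ⟨η, hη, hηN⟩ := hfin
      have hj : 0 < (1 / 2 : ℝ) ^ j * ‖b (2 * j)‖ := mul_pos (by positivity) (hpos _)
      obtain ⟨n, hn⟩ := hδ _ (lt_min hη hj)
      refine ⟨n, ?_, hn.le.trans (min_le_right _ _)⟩
      by_contra! hlt
      exact absurd (hηN n hlt) (not_le.2 (hn.trans_le (min_le_left _ _))))
  obtain ⟨β, hβn⟩ : ∃ β : ℕ → ℂ, ∀ j, ‖β j‖ = ‖b (2 * j)‖⁻¹ :=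
    ⟨fun j => ((‖b (2 * j)‖⁻¹ : ℝ) : ℂ), fun j => by
      rw [Complex.norm_real, Real.norm_of_nonneg (by positivity)]⟩
  have hiff : SeriesConv (fun j => β j • b (2 * j)) ↔ SeriesConv (fun j => β j • b (g j)) :=
    hb.seriesConv_comp strictMono_two_mul hg.injective infinite_compl_range_two_mul hg' β
  have h1 : SeriesConv fun j => β j • b (g j) := by
    apply Summable.seriesConv
    refine Summable.of_norm_bounded summable_half_pow fun j => ?_
    rw [norm_smul, hβn, inv_mul_le_iff₀ (SchauderBasis.norm_pos b _), mul_comm]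
    exact hP j
  have h2 := (hiff.2 h1).tendsto_zero.norm
  rw [norm_zero] at h2
  obtain ⟨j, hj⟩ := (h2.eventually_lt_const one_pos).exists
  rw [norm_smul, hβn, inv_mul_cancel₀ (SchauderBasis.norm_pos b _).ne'] at hj
  exact lt_irrefl _ hj

end Symmetric

/-! ### Gliding humps in `ℓ_p` -/

section GlidingHump

variable {p : ℝ≥0∞}

/-- The norm of a sum of disjointly supported vectors. -/
theorem EllP.norm_sum_rpow_of_disjoint (hp : 0 < p.toReal) {w : ℕ → EllP p}
    (hw : ∀ j j' i, j ≠ j' → w j i = 0 ∨ w j' i = 0) (F : Finset ℕ) :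
    ‖∑ j ∈ F, w j‖ ^ p.toReal = ∑ j ∈ F, ‖w j‖ ^ p.toReal := by
  have hpt : ∀ i, ‖(∑ j ∈ F, w j : EllP p) i‖ ^ p.toReal = ∑ j ∈ F, ‖w j i‖ ^ p.toReal := by
    intro i
    rw [lp.coeFn_sum, Finset.sum_apply]
    by_cases h : ∃ j ∈ F, w j i ≠ 0
    · obtain ⟨j, hj, hji⟩ := h
      have hz : ∀ j' ∈ F, j' ≠ j → w j' i = 0 := fun j' _ hne =>
        (hw j j' i hne.symm).resolve_left hji
      rw [Finset.sum_eq_single_of_mem j hj hz, Finset.sum_eq_single_of_mem j hj]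
      intro j' hj' hne
      rw [hz j' hj' hne, norm_zero, Real.zero_rpow hp.ne']
    · push Not at h
      rw [Finset.sum_eq_zero h, norm_zero, Real.zero_rpow hp.ne']
      exact (Finset.sum_eq_zero fun j hj => by
        rw [h j hj, norm_zero, Real.zero_rpow hp.ne']).symm
  rw [lp.norm_rpow_eq_tsum hp]
  simp only [hpt]
  rw [Summable.tsum_finsetSum fun j _ => (lp.memℓp (w j)).summable hp]
  exact Finset.sum_congr rfl fun j _ => (lp.norm_rpow_eq_tsum hp (w j)).symm

theorem EllP.summable_of_disjoint [Fact (1 ≤ p)] (hp : 0 < p.toReal) {w : ℕ → EllP p}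
    (hw : ∀ j j' i, j ≠ j' → w j i = 0 ∨ w j' i = 0)
    (hs : Summable fun j => ‖w j‖ ^ p.toReal) : Summable w := by
  rw [summable_iff_vanishing_norm] at hs ⊢
  intro ε hε
  obtain ⟨s, h⟩ := hs (ε ^ p.toReal) (by positivity)
  refine ⟨s, fun F hF => ?_⟩
  have h1 := (le_abs_self _).trans_lt (h F hF)
  rw [← EllP.norm_sum_rpow_of_disjoint hp hw] at h1
  exact lt_of_not_ge fun hle => absurd (Real.rpow_le_rpow hε.le hle hp.le) (not_le.2 h1)

theorem EllP.summable_rpow_of_seriesConv [Fact (1 ≤ p)] (hp : 0 < p.toReal) {w : ℕ → EllP p}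
    (hw : ∀ j j' i, j ≠ j' → w j i = 0 ∨ w j' i = 0) (hs : SeriesConv w) :
    Summable fun j => ‖w j‖ ^ p.toReal := by
  obtain ⟨y, hy⟩ := hs
  obtain ⟨C, hC⟩ := hy.norm.bddAbove_range
  refine summable_of_sum_range_le (c := C ^ p.toReal) (fun j => by positivity) fun N => ?_
  rw [← EllP.norm_sum_rpow_of_disjoint hp hw]
  exact Real.rpow_le_rpow (norm_nonneg _) (hC ⟨N, rfl⟩) hp.le

/-- The restriction of `x` to a finite set of indices. -/
noncomputable def EllP.trunc (s : Finset ℕ) (x : EllP p) : EllP p :=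
  ∑ i ∈ s, lp.single p i (x i)

theorem EllP.trunc_apply (s : Finset ℕ) (x : EllP p) (i : ℕ) :
    EllP.trunc s x i = if i ∈ s then x i else 0 := by
  rw [EllP.trunc, lp.coeFn_sum, Finset.sum_apply]
  simp [Pi.single_apply]

/-- A coordinatewise null sequence has a subsequence close to a disjointly supported one. -/
theorem EllP.exists_gliding_hump [Fact (1 ≤ p)] (hp' : p ≠ ∞) {z : ℕ → EllP p}
    (hz : ∀ i, Tendsto (fun j => z j i) atTop (𝓝 0)) {ε : ℕ → ℝ} (hε : ∀ j, 0 < ε j) :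
    ∃ φ : ℕ → ℕ, StrictMono φ ∧ ∃ u : ℕ → EllP p,
      (∀ j j' i, j ≠ j' → u j i = 0 ∨ u j' i = 0) ∧ ∀ j, ‖z (φ j) - u j‖ ≤ ε j := by
  have hp0 : 0 < p := lt_of_lt_of_le one_pos Fact.out
  -- A state is (index, cutoff). The next index makes the vector small below the old cutoff; the
  -- next cutoff then makes its tail small. The hump is what lies between the two cutoffs.
  have hstep : ∀ (j : ℕ) (q : ℕ × ℕ), ∃ q' : ℕ × ℕ, q.1 < q'.1 ∧ q.2 ≤ q'.2 ∧
      ‖EllP.trunc (Finset.range q.2) (z q'.1)‖ ≤ ε j / 2 ∧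
      ‖z q'.1 - EllP.trunc (Finset.range q'.2) (z q'.1)‖ ≤ ε j / 2 := by
    rintro j ⟨n, N⟩
    have hε2 := half_pos (hε j)
    have h1 : Tendsto (fun n' => ‖EllP.trunc (Finset.range N) (z n')‖) atTop (𝓝 0) := by
      have h := tendsto_finsetSum (Finset.range N) (f := fun i n' => ‖z n' i‖) (x := atTop)
        (a := fun _ => 0) (fun i _ => by simpa using (hz i).norm)
      rw [Finset.sum_const_zero] at h
      refine squeeze_zero (fun _ => norm_nonneg _) (fun n' => ?_) h
      refine (norm_sum_le _ _).trans (Finset.sum_le_sum fun i _ => ?_)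
      rw [lp.norm_single hp0]
    obtain ⟨n', hn', hnn'⟩ := ((h1.eventually_le_const hε2).and (eventually_gt_atTop n)).exists
    have h2 : Tendsto (fun N' => ‖z n' - EllP.trunc (Finset.range N') (z n')‖) atTop (𝓝 0) := by
      have := ((lp.hasSum_single hp' (z n')).tendsto_sum_nat.const_sub (z n')).norm
      rwa [sub_self, norm_zero] at this
    obtain ⟨N', hN', hNN'⟩ := ((h2.eventually_le_const hε2).and (eventually_ge_atTop N)).exists
    exact ⟨(n', N'), hnn', hNN', hn', hN'⟩
  choose F hF1 hF2 hF3 hF4 using hstep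
  let s : ℕ → ℕ × ℕ := fun j => Nat.rec (0, 0) F j
  have hs : ∀ j, s (j + 1) = F j (s j) := fun j => rfl
  have hmono : Monotone fun j => (s j).2 :=
    monotone_nat_of_le_succ fun j => by rw [hs]; exact hF2 j (s j)
  refine ⟨fun j => (s (j + 1)).1, strictMono_nat_of_lt_succ fun j => ?_,
    fun j => EllP.trunc (Finset.range (s (j + 1)).2) (z (s (j + 1)).1) -
      EllP.trunc (Finset.range (s j).2) (z (s (j + 1)).1), ?_, fun j => ?_⟩
  · rw [hs (j + 1)]
    exact hF1 (j + 1) (s (j + 1))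
  · have hsupp : ∀ j i, (i < (s j).2 ∨ (s (j + 1)).2 ≤ i) →
        (EllP.trunc (Finset.range (s (j + 1)).2) (z (s (j + 1)).1) -
          EllP.trunc (Finset.range (s j).2) (z (s (j + 1)).1) : EllP p) i = 0 := by
      intro j i hi
      have hle := hmono (Nat.le_succ j)
      simp only [Nat.succ_eq_add_one] at hle
      rw [lp.coeFn_sub, Pi.sub_apply, EllP.trunc_apply, EllP.trunc_apply]
      simp only [Finset.mem_range]
      rcases hi with hi | hi
      · rw [if_pos hi, if_pos (hi.trans_le hle), sub_self]
      · rw [if_neg (by omega), if_neg (by omega), sub_self]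
    have hlt : ∀ j j' i, j < j' → ((EllP.trunc (Finset.range (s (j + 1)).2) (z (s (j + 1)).1) -
          EllP.trunc (Finset.range (s j).2) (z (s (j + 1)).1) : EllP p) i = 0 ∨
        (EllP.trunc (Finset.range (s (j' + 1)).2) (z (s (j' + 1)).1) -
          EllP.trunc (Finset.range (s j').2) (z (s (j' + 1)).1) : EllP p) i = 0) := by
      intro j j' i hjj
      have hle := hmono (Nat.succ_le_of_lt hjj)
      simp only [Nat.succ_eq_add_one] at hle
      rcases lt_or_ge i (s (j + 1)).2 with hi | hi
      · exact Or.inr (hsupp j' i (Or.inl (hi.trans_le hle)))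
      · exact Or.inl (hsupp j i (Or.inr hi))
    intro j j' i hne
    rcases lt_or_gt_of_ne hne with h | h
    · exact hlt j j' i h
    · exact (hlt j' j i h).symm
  · have h3 := hF3 j (s j)
    have h4 := hF4 j (s j)
    rw [← hs] at h3 h4
    calc _ = ‖(z (s (j + 1)).1 - EllP.trunc (Finset.range (s (j + 1)).2) (z (s (j + 1)).1)) +
          EllP.trunc (Finset.range (s j).2) (z (s (j + 1)).1)‖ := by rw [sub_add]
      _ ≤ ε j / 2 + ε j / 2 := (norm_add_le _ _).trans (add_le_add h4 h3)
      _ = ε j := add_halves _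

theorem summable_smul_of_norm_le {E : Type*} [NormedAddCommGroup E] [NormedSpace ℂ E]
    [CompleteSpace E] {v : ℕ → E} {ε B : ℝ} (hv : ∀ j, ‖v j‖ ≤ ε * (1 / 2) ^ j) {β : ℕ → ℂ}
    (hβ : ∀ j, ‖β j‖ ≤ B) : Summable fun j => β j • v j := by
  refine Summable.of_norm_bounded (summable_half_pow.mul_left (B * ε)) fun j => ?_
  rw [norm_smul, mul_assoc]
  exact mul_le_mul (hβ j) (hv j) (norm_nonneg _) ((norm_nonneg _).trans (hβ j))

/-- A bounded coordinatewise null sequence has a subsequence with an upper `ℓ_p` estimate. -/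
theorem EllP.exists_subseq_seriesConv [Fact (1 ≤ p)] (hp' : p ≠ ∞) {z : ℕ → EllP p}
    (hz : ∀ i, Tendsto (fun j => z j i) atTop (𝓝 0)) {M δ : ℝ} (hM : ∀ j, ‖z j‖ ≤ M)
    (hδ : 0 < δ) :
    ∃ φ : ℕ → ℕ, StrictMono φ ∧
      (∀ β : ℕ → ℂ, Memℓp β p → SeriesConv fun j => β j • z (φ j)) ∧
      ((∀ j, δ ≤ ‖z j‖) → ∀ β : ℕ → ℂ, SeriesConv (fun j => β j • z (φ j)) → Memℓp β p) := by
  have hp : 0 < p.toReal :=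
    ENNReal.toReal_pos (lt_of_lt_of_le one_pos Fact.out).ne' hp'
  -- The errors are summable against bounded coefficients, and being at most `δ / 2` they leave `‖u
  -- j‖ ≥ δ / 2` when `‖z j‖ ≥ δ`.
  obtain ⟨φ, hφ, u, hu, hzu⟩ := EllP.exists_gliding_hump hp' hz
    (ε := fun j => δ / 2 * (1 / 2) ^ j) (fun j => by positivity)
  have hsmul : ∀ β : ℕ → ℂ, ∀ j j' i, j ≠ j' → (β j • u j) i = 0 ∨ (β j' • u j') i = 0 := by
    intro β j j' i hne
    simp only [lp.coeFn_smul, Pi.smul_apply, smul_eq_mul, mul_eq_zero]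
    exact (hu j j' i hne).imp Or.inr Or.inr
  have hle : ∀ j, ‖z (φ j) - u j‖ ≤ δ / 2 := fun j => (hzu j).trans <| by
    have : (1 / 2 : ℝ) ^ j ≤ 1 := pow_le_one₀ (by norm_num) (by norm_num)
    nlinarith
  refine ⟨φ, hφ, fun β hβ => ?_, fun hlow β hβ => ?_⟩
  · have hsum := hβ.summable hp
    have h1 : Summable fun j => β j • u j := by
      refine EllP.summable_of_disjoint hp (hsmul β) ?_
      refine Summable.of_nonneg_of_le (fun j => by positivity) (fun j => ?_)
        (hsum.mul_right ((M + δ / 2) ^ p.toReal))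
      rw [norm_smul, Real.mul_rpow (norm_nonneg _) (norm_nonneg _)]
      gcongr
      calc ‖u j‖ = ‖z (φ j) - (z (φ j) - u j)‖ := by rw [sub_sub_cancel]
        _ ≤ ‖z (φ j)‖ + ‖z (φ j) - u j‖ := norm_sub_le _ _
        _ ≤ M + δ / 2 := add_le_add (hM _) (hle j)
    obtain ⟨B, hB⟩ : ∃ B, ∀ j, ‖β j‖ ≤ B :=
      ⟨‖(⟨β, hβ⟩ : EllP p)‖, fun j => lp.norm_apply_le_norm
        (lt_of_lt_of_le one_pos Fact.out).ne' (⟨β, hβ⟩ : EllP p) j⟩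
    have h2 := summable_smul_of_norm_le hzu hB
    refine ((h1.add h2).congr fun j => ?_).seriesConv
    rw [← smul_add, add_sub_cancel]
  · have hB : ∃ B, ∀ j, ‖β j‖ ≤ B := by
      obtain ⟨C, hC⟩ := hβ.tendsto_zero.norm.bddAbove_range
      refine ⟨C / δ, fun j => ?_⟩
      rw [le_div_iff₀ hδ]
      have h := hC ⟨j, rfl⟩
      simp only [norm_smul] at h
      exact (mul_le_mul_of_nonneg_left (hlow (φ j)) (norm_nonneg _)).trans h
    obtain ⟨B, hB⟩ := hB
    have h2 := (summable_smul_of_norm_le hzu hB).seriesConv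
    have h1 : SeriesConv fun j => β j • u j := by
      simpa only [← smul_sub, sub_sub_cancel] using hβ.sub h2
    have h3 := EllP.summable_rpow_of_seriesConv hp (hsmul β) h1
    refine memℓp_gen (Summable.of_nonneg_of_le (fun j => by positivity) (fun j => ?_)
      (h3.mul_right ((2 / δ) ^ p.toReal)))
    rw [← Real.mul_rpow (norm_nonneg _) (by positivity)]
    refine Real.rpow_le_rpow (norm_nonneg _) ?_ hp.le
    have hu2 : δ / 2 ≤ ‖u j‖ := by
      have h4 := norm_sub_norm_le (z (φ j)) (u j)
      linarith [hlow (φ j), hle j]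
    rw [norm_smul]
    calc ‖β j‖ = ‖β j‖ * (δ / 2) * (2 / δ) := by field_simp
      _ ≤ ‖β j‖ * ‖u j‖ * (2 / δ) := by gcongr

end GlidingHump

/-! ### Symmetric bases of `ℓ_p` are equivalent to the standard basis -/

theorem one_lt_toReal {p : ℝ≥0∞} (hp : 1 < p) (hp' : p ≠ ∞) : 1 < p.toReal := by
  rw [← ENNReal.toReal_one]
  exact (ENNReal.toReal_lt_toReal ENNReal.one_ne_top hp').2 hp

theorem memℓp_one_div_succ {p : ℝ≥0∞} (hp : 1 < p.toReal) :
    Memℓp (fun j : ℕ => 1 / ((j : ℂ) + 1)) p := by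
  refine memℓp_gen ?_
  refine ((summable_nat_add_iff 1).2 (Real.summable_one_div_nat_rpow.2 hp)).congr fun j => ?_
  rw [norm_div, norm_one, ← Nat.cast_add_one, Complex.norm_natCast,
    Real.div_rpow zero_le_one (Nat.cast_nonneg _), Real.one_rpow]

theorem not_seriesConv_harmonic : ¬ SeriesConv fun j : ℕ => 1 / ((j : ℂ) + 1) := by
  rintro ⟨y, hy⟩
  have h := (Complex.continuous_re.tendsto y).comp hy
  refine not_tendsto_nhds_of_tendsto_atTop Real.tendsto_sum_range_one_div_nat_succ_atTop y.re
    (h.congr fun N => ?_)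
  rw [Function.comp_apply, Complex.re_sum]
  refine Finset.sum_congr rfl fun j _ => ?_
  rw [show (1 : ℂ) / ((j : ℂ) + 1) = ((1 / ((j : ℝ) + 1) : ℝ) : ℂ) by push_cast; rfl,
    Complex.ofReal_re]

theorem SeriesConv.const_mul {x : ℕ → ℂ} (hx : SeriesConv x) (a : ℂ) :
    SeriesConv fun n => a * x n := by
  obtain ⟨y, hy⟩ := hx
  exact ⟨a * y, by simpa only [Finset.mul_sum] using hy.const_mul a⟩

theorem SeriesConv.map {E F : Type*} [NormedAddCommGroup E] [NormedSpace ℂ E]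
    [NormedAddCommGroup F] [NormedSpace ℂ F] {x : ℕ → E} (hx : SeriesConv x) (T : E →L[ℂ] F) :
    SeriesConv fun n => T (x n) := by
  obtain ⟨y, hy⟩ := hx
  exact ⟨T y, ((T.continuous.tendsto y).comp hy).congr fun N => by simp⟩

section

variable {p : ℝ≥0∞} [Fact (1 ≤ p)] {b : SchauderBasis ℂ (EllP p)}

/-- Every subsequence of a bounded Schauder basis of `ℓ_p`, `p > 1`, has a coordinatewise null
subsequence. -/
theorem SchauderBasis.exists_subseq_tendsto_zero (hp : 1 < p) (hp' : p ≠ ∞) {M : ℝ}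
    (hM : ∀ n, ‖b n‖ ≤ M) {g : ℕ → ℕ} (hg : StrictMono g) :
    ∃ φ : ℕ → ℕ, StrictMono φ ∧ ∀ i, Tendsto (fun j => b (g (φ j)) i) atTop (𝓝 0) := by
  have hp0 : p ≠ 0 := (one_pos.trans hp).ne'
  have hcomp : IsCompact (Set.pi Set.univ fun _ : ℕ => Metric.closedBall (0 : ℂ) M) :=
    isCompact_univ_pi fun _ => isCompact_closedBall _ _
  obtain ⟨c, -, φ, hφ, hc⟩ := hcomp.tendsto_subseq (x := fun j => (b (g j) : ℕ → ℂ)) fun j i _ => by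
    rw [mem_closedBall_zero_iff]
    exact (lp.norm_apply_le_norm hp0 _ i).trans (hM _)
  have hmem : Memℓp c p := lp.memℓp_of_tendsto (l := atTop) (F := fun j => b (g (φ j)))
    (isBounded_iff_forall_norm_le.2 ⟨M, by rintro _ ⟨j, rfl⟩; exact hM _⟩) hc
  refine ⟨φ, hφ, fun i => ?_⟩
  have hci := tendsto_pi_nhds.1 hc
  suffices hx : (⟨c, hmem⟩ : EllP p) = 0 by
    have h0 : c i = 0 := congrFun (congrArg (fun x : EllP p => (x : ℕ → ℂ)) hx) i
    rw [← h0]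
    exact hci i
  set x : EllP p := ⟨c, hmem⟩ with hxdef
  obtain ⟨ψ, hψ, hup, -⟩ := EllP.exists_subseq_seriesConv hp' (z := fun j => b (g (φ j)) - x)
    (fun i => by
      have := (hci i).sub_const (c i)
      rw [sub_self] at this
      exact this)
    (M := M + ‖x‖) (fun j => (norm_sub_le _ _).trans (by gcongr; exact hM _)) one_pos
  refine SchauderBasis.eq_zero_of_coord b fun m => ?_
  by_contra hm
  -- Here `p > 1` enters: `1 / (j + 1)` is in `ℓ_p`. As `b.coord m` kills all but finitely many of
  -- the basis vectors, a nonzero `b.coord m x` would make the harmonic series converge.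
  have hconv := (hup _ (memℓp_one_div_succ (one_lt_toReal hp hp'))).map (b.coord m)
  have hidx : ∀ j, m < j → m ≠ g (φ (ψ j)) := by
    intro j hj h
    have h1 := hg.id_le (φ (ψ j))
    have h2 := hφ.id_le (ψ j)
    have h3 := hψ.id_le j
    simp only [id_eq] at h1 h2 h3
    omega
  have hfin : Summable fun j : ℕ => 1 / ((j : ℂ) + 1) * b.coord m (b (g (φ (ψ j)))) := by
    refine summable_of_ne_finset_zero (s := Finset.range (m + 1)) fun j hj => ?_
    rw [SchauderBasis.coord_self, if_neg, mul_zero]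
    exact hidx j (by simpa using hj)
  have hdiff := (hfin.seriesConv.sub hconv).const_mul (b.coord m x)⁻¹
  refine not_seriesConv_harmonic ?_
  convert hdiff using 2 with j
  rw [map_smul, map_sub, smul_eq_mul]
  field_simp
  ring

namespace IsSymmetricBasis

/-- Some sparse subsequence of a symmetric basis of `ℓ_p` is equivalent to the standard basis. -/
theorem exists_subseq_iff_memℓp (hb : IsSymmetricBasis b) (hp : 1 < p) (hp' : p ≠ ∞) :
    ∃ g : ℕ → ℕ, StrictMono g ∧ (Set.range g)ᶜ.Infinite ∧
      ∀ β : ℕ → ℂ, SeriesConv (fun j => β j • b (g j)) ↔ Memℓp β p := by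
  obtain ⟨M, hM⟩ := hb.exists_norm_le
  obtain ⟨δ, hδ, hδb⟩ := hb.exists_le_norm
  obtain ⟨φ, hφ, hz⟩ := SchauderBasis.exists_subseq_tendsto_zero hp hp' hM strictMono_two_mul
  obtain ⟨ψ, hψ, hup, hlow⟩ := EllP.exists_subseq_seriesConv hp' hz (fun j => hM _) hδ
  refine ⟨fun j => 2 * φ (ψ j), strictMono_two_mul.comp (hφ.comp hψ), ?_,
    fun β => ⟨hlow (fun j => hδb _) β, hup β⟩⟩
  refine infinite_compl_range_two_mul.mono (Set.compl_subset_compl.2 ?_)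
  rintro _ ⟨j, rfl⟩
  exact ⟨φ (ψ j), rfl⟩

/-- The even and odd indices are both sparse, so each half of the series can be compared with the
good subsequence. -/
theorem seriesConv_of_memℓp (hb : IsSymmetricBasis b) (hp : 1 < p) (hp' : p ≠ ∞) {α : ℕ → ℂ}
    (hα : Memℓp α p) : SeriesConv fun n => α n • b n := by
  obtain ⟨g, hg, hg', hiff⟩ := hb.exists_subseq_iff_memℓp hp hp'
  have ht : 0 < p.toReal := one_pos.trans (one_lt_toReal hp hp')
  have key : ∀ h : ℕ → ℕ, StrictMono h → (Set.range h)ᶜ.Infinite →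
      SeriesConv fun n => (Set.range h).indicator (fun n => α n • b n) n := by
    intro h hh hh'
    rw [← seriesConv_comp_iff hh fun n hn => Set.indicator_of_notMem hn _]
    simp only [Set.mem_range_self, Set.indicator_of_mem]
    rw [hb.seriesConv_comp hh hg.injective hh' hg' (fun j => α (h j)), hiff]
    exact memℓp_gen ((hα.summable ht).comp_injective hh.injective)
  have hodd : StrictMono fun j : ℕ => 2 * j + 1 := fun a c h => by simp only; omega
  convert (key _ strictMono_two_mul infinite_compl_range_two_mul).add
    (key _ hodd infinite_compl_range_two_mul_add_one) using 2 with n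
  rcases Nat.even_or_odd' n with ⟨j, rfl | rfl⟩
  · rw [Set.indicator_of_mem (Set.mem_range_self j), Set.indicator_of_notMem, add_zero]
    rintro ⟨i, hi⟩
    simp only at hi
    omega
  · rw [Set.indicator_of_notMem, Set.indicator_of_mem (Set.mem_range_self j), zero_add]
    rintro ⟨i, hi⟩
    simp only at hi
    omega

/-- To avoid splitting a series not known to converge unconditionally, only a sparse set `σ` with
summable coefficients is removed. A permutation sends the remaining indices onto the good
subsequence. -/
theorem memℓp_of_seriesConv (hb : IsSymmetricBasis b) (hp : 1 < p) (hp' : p ≠ ∞) {α : ℕ → ℂ}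
    (hα : SeriesConv fun n => α n • b n) : Memℓp α p := by
  classical
  obtain ⟨g, hg, hg', hiff⟩ := hb.exists_subseq_iff_memℓp hp hp'
  obtain ⟨M, hM⟩ := hb.exists_norm_le
  obtain ⟨δ, hδ, hδb⟩ := hb.exists_le_norm
  have ht : 0 < p.toReal := one_pos.trans (one_lt_toReal hp hp')
  have hα0 : Tendsto (fun n => ‖α n‖) atTop (𝓝 0) := by
    have h := hα.tendsto_zero.norm.div_const δ
    rw [norm_zero, zero_div] at h
    refine squeeze_zero (fun _ => norm_nonneg _) (fun n => ?_) h
    rw [le_div_iff₀ hδ, norm_smul]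
    exact mul_le_mul_of_nonneg_left (hδb n) (norm_nonneg _)
  obtain ⟨σ, hσ, hσ', hσα⟩ := exists_strictMono_infinite_compl
    (P := fun j n => ‖α n‖ ≤ (1 / 2 : ℝ) ^ j)
    (fun j => (hα0.eventually_le_const (by positivity)).frequently)
  have : Infinite ((Set.range σ)ᶜ : Set ℕ) := hσ'.to_subtype
  set h : ℕ → ℕ := fun j => Nat.Subtype.orderIsoOfNat (Set.range σ)ᶜ j with hh
  have hmono : StrictMono h := fun a c hac =>
    (Nat.Subtype.orderIsoOfNat (Set.range σ)ᶜ).strictMono hac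
  have hrange : Set.range h = (Set.range σ)ᶜ := by
    ext n
    constructor
    · rintro ⟨j, rfl⟩
      exact (Nat.Subtype.orderIsoOfNat (Set.range σ)ᶜ j).2
    · intro hn
      exact ⟨(Nat.Subtype.orderIsoOfNat (Set.range σ)ᶜ).symm ⟨n, hn⟩,
        congrArg Subtype.val ((Nat.Subtype.orderIsoOfNat (Set.range σ)ᶜ).apply_symm_apply ⟨n, hn⟩)⟩
  obtain ⟨θ, hθ⟩ := exists_perm_comp_eq hmono.injective hg.injective
    (by rw [hrange, compl_compl]; exact Set.infinite_range_of_injective hσ.injective) hg'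
  have hσsum : Summable fun j => ‖α (σ j)‖ :=
    Summable.of_nonneg_of_le (fun _ => norm_nonneg _) hσα summable_half_pow
  have hsparse : Summable fun n => (Set.range σ).indicator (fun n => α n • b (θ n)) n := by
    rw [← Function.Injective.summable_iff hσ.injective
      (fun n hn => Set.indicator_of_notMem hn _)]
    refine Summable.of_norm_bounded (hσsum.mul_right M) fun j => ?_
    rw [Function.comp_apply, Set.indicator_of_mem (Set.mem_range_self j), norm_smul]
    exact mul_le_mul_of_nonneg_left (hM _) (norm_nonneg _)
  have hconv : SeriesConv fun n => (Set.range h).indicator (fun n => α n • b (θ n)) n := by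
    convert ((hb.seriesConv_perm θ α).1 hα).sub hsparse.seriesConv using 2 with n
    rw [hrange, Set.indicator_compl, Pi.sub_apply]
  rw [← seriesConv_comp_iff hmono fun n hn => Set.indicator_of_notMem hn _] at hconv
  simp only [Set.mem_range_self, Set.indicator_of_mem, hθ] at hconv
  have h1 := ((hiff fun j => α (h j)).1 hconv).summable ht
  have h2 : Summable fun j => ‖α (σ j)‖ ^ p.toReal := by
    refine Summable.of_nonneg_of_le (fun _ => by positivity) (fun j => ?_) hσsum
    calc ‖α (σ j)‖ ^ p.toReal ≤ ‖α (σ j)‖ ^ (1 : ℝ) :=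
          Real.rpow_le_rpow_of_exponent_ge' (norm_nonneg _)
            ((hσα j).trans (pow_le_one₀ (by norm_num) (by norm_num))) zero_le_one
            (one_lt_toReal hp hp').le
      _ = ‖α (σ j)‖ := Real.rpow_one _
  refine memℓp_gen ?_
  have h1' : Summable ((Set.range h).indicator fun n => ‖α n‖ ^ p.toReal) := by
    rw [← Function.Injective.summable_iff hmono.injective
      (fun n hn => Set.indicator_of_notMem hn _)]
    exact h1.congr fun j => by rw [Function.comp_apply, Set.indicator_of_mem (Set.mem_range_self j)]
  have h2' : Summable ((Set.range σ).indicator fun n => ‖α n‖ ^ p.toReal) := by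
    rw [← Function.Injective.summable_iff hσ.injective
      (fun n hn => Set.indicator_of_notMem hn _)]
    exact h2.congr fun j => by rw [Function.comp_apply, Set.indicator_of_mem (Set.mem_range_self j)]
  refine (h1'.add h2').congr fun n => ?_
  rw [hrange, ← Pi.add_apply, Set.indicator_compl_add_self]

/-- The isomorphism of `ℓ_p` taking the standard basis to a symmetric basis. -/
theorem exists_continuousLinearEquiv (hb : IsSymmetricBasis b) (hp : 1 < p) (hp' : p ≠ ∞) :
    ∃ T : EllP p ≃L[ℂ] EllP p, ∀ x : EllP p, SeriesTendsTo b x (T x) := by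
  have hconv : ∀ x : EllP p, ∃ y, SeriesTendsTo b x y := fun x =>
    hb.seriesConv_of_memℓp hp hp' (lp.memℓp x)
  choose T hT using hconv
  let G : ℕ → EllP p →L[ℂ] EllP p := fun N =>
    ∑ n ∈ Finset.range N, (lp.evalCLM ℂ (fun _ : ℕ => ℂ) p n).smulRight (b n)
  have hG : ∀ N (x : EllP p), G N x = ∑ n ∈ Finset.range N, x n • b n := fun N x => by
    simp only [G, _root_.sum_apply, ContinuousLinearMap.smulRight_apply]
    rfl
  -- Banach–Steinhaus gives continuity of the pointwise limit; the open mapping theorem will give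
  -- that of the inverse.
  let S : EllP p →L[ℂ] EllP p := continuousLinearMapOfTendsto G (f := T)
    (tendsto_pi_nhds.2 fun x => (hT x).congr fun N => (hG N x).symm)
  have hS : ∀ x : EllP p, SeriesTendsTo b x (S x) := hT
  have hker : S.ker = ⊥ := by
    rw [LinearMap.ker_eq_bot']
    intro x hx
    ext n
    have := (hS x).coord_eq n
    rw [show S x = 0 from hx, map_zero] at this
    exact this.symm
  have hrange : S.range = ⊤ := by
    rw [LinearMap.range_eq_top]
    intro y
    have hy := SchauderBasis.tendsto_expansion b y
    have hmem : Memℓp (fun n => b.coord n y) p := hb.memℓp_of_seriesConv hp hp' ⟨y, hy⟩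
    exact ⟨⟨_, hmem⟩, tendsto_nhds_unique (hS (⟨_, hmem⟩ : EllP p)) hy⟩
  exact ⟨ContinuousLinearEquiv.ofBijective S hker hrange, hS⟩

end IsSymmetricBasis

end

/-! ### The resolvent -/

section

variable {p : ℝ≥0∞}

/-- Multiplication by `1 / (i f(n) - λ)` in the space of formal series. -/
noncomputable def resolventOp (hp : 1 < p.toReal) {k : ℕ} {f : ℕ → ℝ} (hf : ClassS k f) {lam : ℂ}
    (hl : lam.re ≠ 0) : FormalSpace p k →ₗ[ℂ] FormalSpace p k where
  toFun x := ⟨resolventSeq f lam * x, by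
    obtain ⟨C, -, hC⟩ := hf.exists_seqNormLE_resolventSeq_mul hp
    exact (hC (min 1 |lam.re|) lam x _ (lt_min one_pos (abs_pos.2 hl)) (min_le_left _ _)
      (min_le_right _ _) (SeqNormLE.of_lp (one_pos.trans hp) (⟨_, x.2⟩ : EllP p))).memℓp⟩
  map_add' x y := Subtype.ext (mul_add _ _ _)
  map_smul' r x := Subtype.ext (mul_smul_comm _ _ _)

theorem isResolventAt_resolventOp (hp : 1 < p.toReal) {k : ℕ} {f : ℕ → ℝ} (hf : ClassS k f)
    {lam : ℂ} (hl : lam.re ≠ 0) :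
    IsResolventAt (opA p k f) lam (resolventOp hp hf hl) := by
  have hinv : ∀ n, (Complex.I * (f n : ℂ) - lam) * resolventSeq f lam n = 1 := fun n =>
    mul_inv_cancel₀ (I_mul_sub_ne_zero hl (f n))
  constructor
  · intro x
    have hdom : resolventOp hp hf hl x ∈ (opA p k f).domain := by
      change realMulSeq f (resolventSeq f lam * x) ∈ FormalSpace p k
      -- From `(i f - λ) g = 1`, the product `f g x` is a combination of `x` and `g x`, both already
      -- in the space.
      have : realMulSeq f (resolventSeq f lam * x) =
          (-Complex.I) • ((x : ℕ → ℂ) + lam • (resolventOp hp hf hl x : ℕ → ℂ)) := by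
        funext n
        change (f n : ℂ) * (resolventSeq f lam n * (x : ℕ → ℂ) n) =
          -Complex.I * ((x : ℕ → ℂ) n + lam * (resolventSeq f lam n * (x : ℕ → ℂ) n))
        linear_combination (-Complex.I * (x : ℕ → ℂ) n) * hinv n +
          ((f n : ℂ) * resolventSeq f lam n * (x : ℕ → ℂ) n) * Complex.I_mul_I
      rw [this]
      exact (FormalSpace p k).smul_mem _ ((FormalSpace p k).add_mem x.2
        ((FormalSpace p k).smul_mem _ (resolventOp hp hf hl x).2))
    refine ⟨hdom, Subtype.ext (funext fun n => ?_)⟩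
    change Complex.I * (f n : ℂ) * (resolventSeq f lam n * (x : ℕ → ℂ) n) -
      lam * (resolventSeq f lam n * (x : ℕ → ℂ) n) = (x : ℕ → ℂ) n
    linear_combination (x : ℕ → ℂ) n * hinv n
  · intro z
    refine Subtype.ext (funext fun n => ?_)
    change resolventSeq f lam n * (Complex.I * (f n : ℂ) * ((z : FormalSpace p k) : ℕ → ℂ) n -
      lam * ((z : FormalSpace p k) : ℕ → ℂ) n) = ((z : FormalSpace p k) : ℕ → ℂ) n
    linear_combination ((z : FormalSpace p k) : ℕ → ℂ) n * hinv n

variable [Fact (1 ≤ p)] {b : SchauderBasis ℂ (EllP p)}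

theorem formalNorm_eq {T : EllP p ≃L[ℂ] EllP p} (hT : ∀ x : EllP p, SeriesTendsTo b x (T x))
    {k : ℕ} (x : FormalSpace p k) : formalNorm b x = ‖T ⟨(diffOp ℂ ^ k) x, x.2⟩‖ := by
  rw [formalNorm]
  congr 1
  exact (hT ⟨(diffOp ℂ ^ k) x, x.2⟩).limUnder_eq

theorem exists_formalNorm_resolventOp_le {T : EllP p ≃L[ℂ] EllP p}
    (hT : ∀ x : EllP p, SeriesTendsTo b x (T x)) (hp : 1 < p.toReal) {k : ℕ} {f : ℕ → ℝ}
    (hf : ClassS k f) : ∃ C : ℝ, 0 ≤ C ∧ ∀ (s : ℝ) (lam : ℂ) (hl : lam.re ≠ 0)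
      (x : FormalSpace p k), 0 < s → s ≤ 1 → s ≤ |lam.re| →
        formalNorm b (resolventOp hp hf hl x) ≤ C / s ^ (k + 1) * formalNorm b x := by
  obtain ⟨C, hC, h⟩ := hf.exists_seqNormLE_resolventSeq_mul hp
  have hp0 := one_pos.trans hp
  refine ⟨‖(T : EllP p →L[ℂ] EllP p)‖ * C * ‖(T.symm : EllP p →L[ℂ] EllP p)‖, by positivity,
    fun s lam hl x hs hs1 hsl => ?_⟩
  set a : EllP p := ⟨(diffOp ℂ ^ k) x, x.2⟩ with ha
  set a' : EllP p := ⟨(diffOp ℂ ^ k) (resolventOp hp hf hl x : ℕ → ℂ),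
    (resolventOp hp hf hl x).2⟩ with ha'
  rw [formalNorm_eq hT, formalNorm_eq hT, ← ha, ← ha']
  have h1 : ‖a'‖ ≤ C / s ^ (k + 1) * ‖a‖ :=
    SeqNormLE.norm_le hp0 (h s lam x _ hs hs1 hsl (SeqNormLE.of_lp hp0 a))
  have h2 : ‖a‖ ≤ ‖(T.symm : EllP p →L[ℂ] EllP p)‖ * ‖T a‖ := by
    simpa using (T.symm : EllP p →L[ℂ] EllP p).le_opNorm (T a)
  calc ‖T a'‖ ≤ ‖(T : EllP p →L[ℂ] EllP p)‖ * ‖a'‖ := (T : EllP p →L[ℂ] EllP p).le_opNorm a'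
    _ ≤ ‖(T : EllP p →L[ℂ] EllP p)‖ *
        (C / s ^ (k + 1) * (‖(T.symm : EllP p →L[ℂ] EllP p)‖ * ‖T a‖)) := by
      gcongr
      exact h1.trans (by gcongr)
    _ = _ := by ring

end

theorem theorem4p2 (p : ℝ≥0∞) [Fact (1 ≤ p)] (hp : 1 < p) (hp' : p ≠ ∞)
    (b : SchauderBasis ℂ (EllP p)) (hb : IsSymmetricBasis b)
    (k : ℕ) (hk : 1 ≤ k) (f : ℕ → ℝ) (hf : ClassS k f) :
    (∀ x : FormalSpace p k, ∃ y : EllP p, SeriesTendsTo b ((diffOp ℂ ^ k) (x : ℕ → ℂ)) y) ∧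
    ∀ a : ℝ, 0 < a → ∃ C : ℝ, 0 < C ∧
      (∀ lam : ℂ, 0 < |lam.re| → |lam.re| < a →
        ResolventNormLE (formalNorm b) (opA p k f) lam (C / |lam.re| ^ (k + 1))) ∧
      (∀ lam : ℂ, a ≤ |lam.re| →
        ResolventNormLE (formalNorm b) (opA p k f) lam C) := by
  obtain ⟨T, hT⟩ := hb.exists_continuousLinearEquiv hp hp'
  refine ⟨fun x => ⟨_, hT ⟨_, x.2⟩⟩, fun a ha => ?_⟩
  have ht := one_lt_toReal hp hp'
  obtain ⟨C, hC, hbound⟩ := exists_formalNorm_resolventOp_le hT ht hf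
  have hN : ∀ x : FormalSpace p k, 0 ≤ formalNorm b x := fun x => norm_nonneg _
  have hs : 0 < min 1 a := lt_min one_pos ha
  -- The first summand comes from `s = |Re λ| / max 1 a`, the second from `s = min 1 a`; the `1`
  -- ensures positivity, since `C` may vanish.
  refine ⟨C * max 1 a ^ (k + 1) + C / min 1 a ^ (k + 1) + 1, by positivity,
    fun lam hl hla => ?_, fun lam hl => ?_⟩
  · refine ⟨resolventOp ht hf (abs_pos.1 hl), isResolventAt_resolventOp ht hf _, fun x => ?_⟩
    have hmax : 0 < max 1 a := one_pos.trans_le (le_max_left _ _)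
    refine (hbound (|lam.re| / max 1 a) lam (abs_pos.1 hl) x (by positivity)
      ((div_le_one hmax).2 (hla.le.trans (le_max_right _ _)))
      (div_le_self hl.le (le_max_left _ _))).trans ?_
    refine mul_le_mul_of_nonneg_right ?_ (hN x)
    rw [div_pow, div_div_eq_mul_div]
    gcongr
    have : 0 ≤ C / min 1 a ^ (k + 1) := by positivity
    linarith
  · have hl0 : lam.re ≠ 0 := abs_pos.1 (ha.trans_le hl)
    refine ⟨resolventOp ht hf hl0, isResolventAt_resolventOp ht hf _, fun x => ?_⟩
    refine (hbound (min 1 a) lam hl0 x hs (min_le_left _ _)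
      ((min_le_right _ _).trans hl)).trans ?_
    refine mul_le_mul_of_nonneg_right ?_ (hN x)
    have : 0 ≤ C * max 1 a ^ (k + 1) := by positivity
    linarith
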